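/- Let $d\ge 1$, $\tfrac12<H<1$, and let $f$ be the Riesz kernel of order $\alpha$ on $\mathbb R^d$, with $0<\alpha<d$ and $\alpha>d-2$, whose spectral measure is $\mu(d\xi)=|\xi|^{-\alpha}d\xi$; let $\mathcal F\phi(\xi)=\int_{\mathbb R^d} e^{-i\xi\cdot x}\phi(x)\,dx$. Let $G(t,\cdot)$ be the fundamental solution of the wave operator $\partial_t^2-\Delta$ on $\mathbb R^d$, i.e. the tempered distribution with $\mathcal FG(t,\cdot)(\xi)=\sin(t|\xi|)/|\xi|$. For $t>0$, $x\in\mathbb R^d$, $n\ge1$ and $0<t_1<\dots<t_n<t$ let $f_n(t_1,\cdot,\dots,t_n,\cdot,t,x)$ be the distribution $$G(t-t_n,x-x_n)\,G(t_n-t_{n-1},x_n-x_{n-1})\cdots G(t_2-t_1,x_2-x_1)$$ in $(x_1,\dots,x_n)\in\mathbb R^{nd}$, defined by $$(f_n(t_1,\cdot,\dots,t_n,\cdot,t,x),\phi_1\otimes\cdots\otimes\phi_n)=\varphi_n(x),\qquad \varphi_0=1,\quad \varphi_k=(\phi_k\varphi_{k-1})*G(t_{k+1}-t_k,\cdot)\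 \ (1\le k\le n,\ t_{n+1}:=t)$$ for Schwartz functions $\phi_1,\dots,\phi_n$ on $\mathbb R^d$, and let $f_n(t_1,\cdot,\dots,t_n,\cdot,t,x)=0$ for all other $(t_1,\dots,t_n)$. Let $\tilde f_n(\cdot,t,x)$ be the symmetrization of $f_n(\cdot,t,x)$ in the variables $(t_1,x_1),\dots,(t_n,x_n)$. Put $\tilde\alpha_n(t)=(n!)^2\|\tilde f_n(\cdot,t,x)\|^2_{\mathcal{HP}^{\otimes n}}$, where, with $\alpha_H=H(2H-1)$, $$\|\varphi\|^2_{\mathcal{HP}^{\otimes n}}=\alpha_H^n\int_{(0,t)^{2n}}\prod_{j=1}^n|t_j-s_j|^{2H-2}\int_{\mathbb R^{nd}}\mathcal F\varphi(t_1,\cdot,\dots,t_n,\cdot)(\xi)\,\overline{\mathcal F\varphi(s_1,\cdot,\dots,s_n,\cdot)(\xi)}\,\mu(d\xi_1)\cdots\mu(d\xi_n)\,d\mathbf t\,d\mathbf s .$$ Then there is a constant $C_{\alpha,d,H}>0$, depending only on $\alpha,d,H$, such that for all $t>0$, $x\in\mathbb R^d$ and $n\ge1$ the Fourier transforms $\mathcal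 F\tilde f_n(t_1,\cdot,\dots,t_n,\cdot,t,x)$ are functions, the inner and the outer integral defining $\|\tilde f_n(\cdot,t,x)\|^2_{\mathcal{HP}^{\otimes n}}$ converge absolutely, and $$\tilde\alpha_n(t)\le C(t)^n\,\frac1{(n!)^{\alpha-d+2}},\qquad C(t)=C_{\alpha,d,H}\,t^{2H+\alpha-d+2}.$$ -/

import Mathlib

open MeasureTheory SchwartzMap
open scoped FourierTransform Real ENNReal ComplexConjugate

noncomputable section

namespace FractionalWave

/-- The physical space `ℝᵈ` with its Euclidean norm. -/
abbrev Space (d : ℕ) : Type := EuclideanSpace ℝ (Fin d)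

section Fourier

variable {d : ℕ}

/-- The dilation `ξ ↦ ξ / (2π)` of `ℝᵈ`. -/
def dilation (d : ℕ) : Space d ≃L[ℝ] Space d :=
  ContinuousLinearEquiv.smulLeft (Units.mk0 ((2 * π)⁻¹ : ℝ) (by positivity))

/-- The Fourier transform in the angular convention, `ℱφ(ξ) = ∫ e^{-iξ·x} φ(x) dx`, as a continuous
linear operator on Schwartz functions (Mathlib's `𝓕` is `∫ e^{-2πiξ·x} φ(x) dx`). -/
def angularFourier (d : ℕ) : 𝓢(Space d, ℂ) →L[ℂ] 𝓢(Space d, ℂ) :=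
  (compCLMOfContinuousLinearEquiv ℂ (dilation d)).comp
    (FourierTransform.fourierCLM ℂ 𝓢(Space d, ℂ))

/-- The inverse of `angularFourier`. -/
def angularFourierInv (d : ℕ) : 𝓢(Space d, ℂ) →L[ℂ] 𝓢(Space d, ℂ) :=
  (FourierTransform.fourierInvCLM ℂ 𝓢(Space d, ℂ)).comp
    (compCLMOfContinuousLinearEquiv ℂ (dilation d).symm)

theorem angularFourier_apply (φ : 𝓢(Space d, ℂ)) (ξ : Space d) :
    angularFourier d φ ξ = ∫ x, Complex.exp (-Complex.I * (inner ℝ ξ x : ℝ)) * φ x := by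
  have h1 : angularFourier d φ ξ = 𝓕 (φ : Space d → ℂ) ((2 * π)⁻¹ • ξ) := rfl
  rw [h1, Real.fourier_eq']
  refine integral_congr_ae (Filter.Eventually.of_forall fun x => ?_)
  simp only [smul_eq_mul]
  congr 2
  rw [inner_smul_right, real_inner_comm]
  have : (π : ℂ) ≠ 0 := by exact_mod_cast Real.pi_ne_zero
  push_cast
  field_simp

theorem angularFourierInv_angularFourier (φ : 𝓢(Space d, ℂ)) :
    angularFourierInv d (angularFourier d φ) = φ := by
  have h : compCLMOfContinuousLinearEquiv ℂ (dilation d).symm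
      (compCLMOfContinuousLinearEquiv ℂ (dilation d) (𝓕 φ)) = 𝓕 φ := by
    ext x; simp
  simp [angularFourier, angularFourierInv, h]

theorem angularFourier_angularFourierInv (φ : 𝓢(Space d, ℂ)) :
    angularFourier d (angularFourierInv d φ) = φ := by
  ext x
  simp [angularFourier, angularFourierInv]

end Fourier

section FundamentalSolution

variable {d : ℕ}

/-- The function `ξ ↦ sin(s|ξ|)/|ξ|` (equal to `s` at `ξ = 0`). -/
def waveSymbol (s : ℝ) (ξ : Space d) : ℂ := ((s * Real.sinc (s * ‖ξ‖) : ℝ) : ℂ)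

theorem waveSymbol_eq (s : ℝ) (ξ : Space d) (hξ : ξ ≠ 0) :
    waveSymbol s ξ = ((Real.sin (s * ‖ξ‖) / ‖ξ‖ : ℝ) : ℂ) := by
  have hξ' : ‖ξ‖ ≠ 0 := norm_ne_zero_iff.2 hξ
  rcases eq_or_ne s 0 with rfl | hs
  · simp [waveSymbol]
  · rw [waveSymbol, Real.sinc_of_ne_zero (mul_ne_zero hs hξ')]
    congr 1
    field_simp

theorem memLp_waveSymbol (s : ℝ) :
    MemLp (waveSymbol s : Space d → ℂ) ∞ (volume : Measure (Space d)) := by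
  refine memLp_top_of_bound (C := |s|) ?_ (Filter.Eventually.of_forall fun ξ => ?_)
  · have : Continuous (waveSymbol s : Space d → ℂ) := by
      unfold waveSymbol
      exact Complex.continuous_ofReal.comp
        (continuous_const.mul (Real.continuous_sinc.comp (continuous_const.mul continuous_norm)))
    exact this.aestronglyMeasurable
  · rw [waveSymbol, Complex.norm_real, Real.norm_eq_abs, abs_mul]
    exact mul_le_of_le_one_right (abs_nonneg _) (Real.abs_sinc_le_one _)

/-- The fundamental solution `G(s, ·)` of the wave operator `∂²/∂s² - Δ` on `ℝᵈ`: the tempered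
distribution whose Fourier transform is `sin(s|ξ|)/|ξ|`, i.e. `(G(s, ·), ℱh) = ∫ ℱG(s, ·)(ξ) h(ξ) dξ`
for every Schwartz function `h`. -/
def waveG (d : ℕ) (s : ℝ) : 𝓢'(Space d, ℂ) :=
  PointwiseConvergenceCLM.precomp ℂ (angularFourierInv d)
    (((memLp_waveSymbol (d := d) s).toLp (waveSymbol s) : Lp ℂ ∞ (volume : Measure (Space d)))
      : 𝓢'(Space d, ℂ))

theorem waveG_angularFourier (s : ℝ) (h : 𝓢(Space d, ℂ)) :
    waveG d s (angularFourier d h) = ∫ ξ, waveSymbol s ξ * h ξ := by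
  have h1 : waveG d s (angularFourier d h) =
      (((memLp_waveSymbol (d := d) s).toLp (waveSymbol s) : Lp ℂ ∞ (volume : Measure (Space d)))
        : 𝓢'(Space d, ℂ)) (angularFourierInv d (angularFourier d h)) := rfl
  rw [h1, angularFourierInv_angularFourier, Lp.toTemperedDistribution_apply]
  refine integral_congr_ae ?_
  filter_upwards [(memLp_waveSymbol (d := d) s).coeFn_toLp] with ξ hξ
  rw [hξ, smul_eq_mul, mul_comm]

/-- The convolution `(ψ * T)(x) = (T, ψ(x - ·))` of a Schwartz function with a tempered
distribution. -/
def conv (ψ : 𝓢(Space d, ℂ)) (T : 𝓢'(Space d, ℂ)) (x : Space d) : ℂ :=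
  T (compSubConstCLM ℂ x (compCLMOfContinuousLinearEquiv ℂ (ContinuousLinearEquiv.neg ℝ) ψ))

end FundamentalSolution

section Kernels

variable {d n : ℕ}

/-- A distribution on `ℝⁿᵈ`, given by its action on the tensor products `φ₁ ⊗ ⋯ ⊗ φₙ` of Schwartz
functions on `ℝᵈ` (which determines it). -/
abbrev TensorAction (d n : ℕ) : Type := (Fin n → 𝓢(Space d, ℂ)) → ℂ

/-- The functions `φₖ(s₁, …, sₖ, ·)` of the recursion `φ₀ = 1`, `ψₖ = ϕₖ φₖ₋₁`, `φₖ = ψₖ * G(sₖ, ·)`,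
where `ϕ₁, …, ϕₖ` are the test functions and the product `ψₖ` is again a Schwartz function. -/
def iteratedConv : (n : ℕ) → (Fin n → 𝓢(Space d, ℂ)) → (Fin n → ℝ) → Space d → ℂ
  | 0, _, _ => fun _ => 1
  | n + 1, ϕ, s =>
      conv (smulLeftCLM ℂ (iteratedConv n (Fin.init ϕ) (Fin.init s)) (ϕ (Fin.last n)))
        (waveG d (s (Fin.last n)))

/-- The distribution
`fₙ(t₁, ·, …, tₙ, ·, t, x) = G(t - tₙ, x - xₙ) G(tₙ - tₙ₋₁, xₙ - xₙ₋₁) ⋯ G(t₂ - t₁, x₂ - x₁)`,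
for `0 < t₁ < ⋯ < tₙ < t`, and `0` for all other `(t₁, …, tₙ)`. The time increments are
`t₂ - t₁, …, tₙ - tₙ₋₁, t - tₙ`. -/
def kernel (t : ℝ) (x : Space d) (τ : Fin n → ℝ) : TensorAction d n :=
  open Classical in
  fun ϕ =>
    if StrictMono τ ∧ ∀ j, τ j ∈ Set.Ioo 0 t then
      iteratedConv n ϕ (fun j => (Fin.snoc τ t : Fin (n + 1) → ℝ) j.succ - τ j) x
    else 0

/-- The symmetrization
`f̃(t₁, x₁, …, tₙ, xₙ) = (1/n!) ∑_ρ f(t_ρ(1), x_ρ(1), …, t_ρ(n), x_ρ(n))`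
of a distribution-valued function of the times. -/
def symmetrize (f : (Fin n → ℝ) → TensorAction d n) (τ : Fin n → ℝ) : TensorAction d n :=
  fun ϕ => (n.factorial : ℂ)⁻¹ * ∑ ρ : Equiv.Perm (Fin n), f (τ ∘ ρ) (ϕ ∘ ρ)

/-- The Fourier transform of the distribution `T` on `ℝⁿᵈ` is the function `K`:
`(T, ℱh₁ ⊗ ⋯ ⊗ ℱhₙ) = ∫ K(ξ₁, …, ξₙ) h₁(ξ₁) ⋯ hₙ(ξₙ) dξ₁ ⋯ dξₙ`. -/
def IsFourierFunction (T : TensorAction d n) (K : (Fin n → Space d) → ℂ) : Prop :=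
  AEStronglyMeasurable K volume ∧
    ∀ h : Fin n → 𝓢(Space d, ℂ),
      Integrable (fun ξ : Fin n → Space d => K ξ * ∏ j, h j (ξ j)) ∧
        T (fun j => angularFourier d (h j)) = ∫ ξ : Fin n → Space d, K ξ * ∏ j, h j (ξ j)

/-- The Fourier transform of a distribution on `ℝⁿᵈ`, when it is a function (which is then unique up
to null sets); `0` otherwise. -/
def fourierFunction (T : TensorAction d n) : (Fin n → Space d) → ℂ :=
  open Classical in
  if h : ∃ K, IsFourierFunction T K then h.choose else 0

end Kernels

section Norm

variable {d n : ℕ}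

/-- The spectral measure `μ(dξ) = |ξ|^{-α} dξ` of the Riesz kernel of order `α` on `ℝᵈ`. -/
def rieszMeasure (d : ℕ) (α : ℝ) : Measure (Space d) :=
  volume.withDensity fun ξ => ENNReal.ofReal (‖ξ‖ ^ (-α))

/-- The spatial inner product
`∫ ℱφ(τ, ·)(ξ) conj (ℱφ(σ, ·)(ξ)) μ(dξ₁) ⋯ μ(dξₙ)` at the times `τ` and `σ`. -/
def spatialInner (α : ℝ) (φ : (Fin n → ℝ) → TensorAction d n) (τ σ : Fin n → ℝ) : ℂ :=
  ∫ ξ : Fin n → Space d, fourierFunction (φ τ) ξ * conj (fourierFunction (φ σ) ξ)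
    ∂(Measure.pi fun _ => rieszMeasure d α)

/-- The open cube `(0, t)ⁿ`. -/
def timeCube (n : ℕ) (t : ℝ) : Set (Fin n → ℝ) := Set.univ.pi fun _ => Set.Ioo 0 t

/-- The integrand `∏ⱼ |τⱼ - σⱼ|^{2H-2} ∫ ℱφ(τ, ·)(ξ) conj (ℱφ(σ, ·)(ξ)) μ(dξ₁) ⋯ μ(dξₙ)`. -/
def timeIntegrand (α H : ℝ) (φ : (Fin n → ℝ) → TensorAction d n)
    (p : (Fin n → ℝ) × (Fin n → ℝ)) : ℂ :=
  ((∏ j, |p.1 j - p.2 j| ^ (2 * H - 2) : ℝ) : ℂ) * spatialInner α φ p.1 p.2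

/-- The integrals that define the squared `𝓗𝓟^{⊗n}`-norm of `φ` converge absolutely, for `φ`
supported in `(0, t)ⁿ`. -/
structure HasFiniteNorm (α H t : ℝ) (φ : (Fin n → ℝ) → TensorAction d n) : Prop where
  exists_fourier : ∀ τ ∈ timeCube n t, ∃ K, IsFourierFunction (φ τ) K
  integrable_space : ∀ τ ∈ timeCube n t, ∀ σ ∈ timeCube n t,
    Integrable (fun ξ : Fin n → Space d => fourierFunction (φ τ) ξ * conj (fourierFunction (φ σ) ξ))
      (Measure.pi fun _ => rieszMeasure d α)
  integrable_time : IntegrableOn (timeIntegrand α H φ) (timeCube n t ×ˢ timeCube n t)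

/-- The squared norm of `𝓗𝓟^{⊗n}`, for `φ` supported in `(0, t)ⁿ`:
`α_H^n ∫_{(0,t)^{2n}} ∏ⱼ |τⱼ - σⱼ|^{2H-2} ∫ ℱφ(τ, ·)(ξ) conj (ℱφ(σ, ·)(ξ)) μ(dξ₁) ⋯ μ(dξₙ) dτ dσ`
with `α_H = H(2H-1)`. The integral is real, by the symmetry in `τ` and `σ`. -/
def normSq (α H t : ℝ) (φ : (Fin n → ℝ) → TensorAction d n) : ℝ :=
  (H * (2 * H - 1)) ^ n *
    (∫ p in timeCube n t ×ˢ timeCube n t, timeIntegrand α H φ p).re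

/-- `α̃ₙ(t) = (n!)² ‖f̃ₙ(·, t, x)‖²`. -/
def alphaTilde (α H t : ℝ) (x : Space d) (n : ℕ) : ℝ :=
  (n.factorial : ℝ) ^ 2 * normSq α H t (symmetrize (kernel (n := n) t x))

end Norm

end FractionalWave

end

/-! Write β = α - d + 2 > 0, and let u₁, …, uₙ be the increments of ordered times. On the Fourier
side, each multiplication by a test function adds a frequency and each convolution with G(uⱼ, ·)
multiplies by the wave symbol at the accumulated frequency. Hence the kernel has the transform
e^{-i(ξ₁+⋯+ξₙ)·x} ∏ⱼ sin(uⱼ|ξ₁+⋯+ξⱼ|)/|ξ₁+⋯+ξⱼ| (`iteratedConv_angularFourier`), and x enters only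
through a phase. Since `fourierFunction` is an arbitrary choice,
`ae_eq_zero_of_integral_prod_schwartz_eq_zero` is needed to identify it with this formula almost
everywhere.

The squared modulus is integrated against μ one frequency at a time, the last one first. Each
integration costs at most c uⱼ^β, uniformly in the shift by the earlier frequencies
(`exists_lintegral_waveSymbol_le`, `lintegral_waveMult_le`). The power of uⱼ comes from scaling;
convergence at the origin uses α < d, and at infinity α > d - 2. The remaining integral of ∏ⱼ uⱼ^β
over ordered times is at most K^n t^{n(β+1)} / (n!)^{β+1} (`lintegral_orderedTimes_le`).

The n! permuted kernels live on disjoint sets of times, so symmetrization produces no cross terms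
and the time integral of the squared spatial norm gains a factor 1/n!. The two time variables are
decoupled by |a conj b| ≤ |a|² + |b|² and a Schur test: integrating |τⱼ - σⱼ|^{2H-2} in σⱼ costs at
most 2t^{2H-1}/(2H-1) (`lintegral_timeIntegrand_le`). Altogether n! has exponent 2 - 1 - (β+1) = -β,
and t has exponent n(2H-1+β+1) = n(2H+β). -/

noncomputable section

namespace FractionalWave

/-! ### Splitting off the last coordinate of a product space -/

section Snoc

variable {X : Type*} [MeasurableSpace X] {n : ℕ}

theorem snoc_eq_piFinSuccAbove_symm (p : X × (Fin n → X)) :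
    (Fin.snoc p.2 p.1 : Fin (n + 1) → X) =
      (MeasurableEquiv.piFinSuccAbove (fun _ => X) (Fin.last n)).symm p := by
  simp [MeasurableEquiv.piFinSuccAbove_symm_apply, Fin.insertNthEquiv, Fin.insertNth_last']

theorem measurableEmbedding_snoc :
    MeasurableEmbedding fun p : X × (Fin n → X) => (Fin.snoc p.2 p.1 : Fin (n + 1) → X) := by
  simp_rw [snoc_eq_piFinSuccAbove_symm]
  exact MeasurableEquiv.measurableEmbedding _

theorem measurePreserving_snoc (μ : Measure X) [SigmaFinite μ] :
    MeasurePreserving (fun p : X × (Fin n → X) => (Fin.snoc p.2 p.1 : Fin (n + 1) → X))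
      (μ.prod (Measure.pi fun _ => μ)) (Measure.pi fun _ => μ) := by
  simp_rw [snoc_eq_piFinSuccAbove_symm]
  exact (measurePreserving_piFinSuccAbove (fun _ : Fin (n + 1) => μ) (Fin.last n)).symm _

end Snoc

/-! ### Convolution with G as multiplication of a Fourier amplitude -/

section Duality

variable {d : ℕ} {V : Type*} [MeasurableSpace V] {ν : Measure V} [SFinite ν]

theorem norm_exp_neg_I_mul (r : ℝ) : ‖Complex.exp (-Complex.I * (r : ℂ))‖ = 1 := by
  rw [Complex.norm_exp]; simp

/-- Fubini. The frequency map η on a general measure space V lets ψ be a Fourier integral over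
several frequencies at once, of which only η(ω), later their sum, pairs with y. -/
theorem integral_mul_eq_integral_angularFourier_mul {η : V → Space d} (hη : Measurable η)
    {F : V → ℂ} (hF : Integrable F ν) {ψ : Space d → ℂ}
    (hψ : ∀ y, ψ y = ∫ ω, Complex.exp (-Complex.I * (inner ℝ (η ω) y : ℝ)) * F ω ∂ν)
    (k : 𝓢(Space d, ℂ)) :
    ∫ y, k y * ψ y = ∫ ω, angularFourier d k (η ω) * F ω ∂ν := by
  have hint : Integrable (fun p : Space d × V =>
      Complex.exp (-Complex.I * (inner ℝ (η p.2) p.1 : ℝ)) * (k p.1 * F p.2))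
      (volume.prod ν) := by
    refine Integrable.bdd_mul (c := 1) (k.integrable.mul_prod hF) ?_ ?_
    · refine Measurable.aestronglyMeasurable ?_
      have : Measurable fun p : Space d × V => (inner ℝ (η p.2) p.1 : ℝ) :=
        (hη.comp measurable_snd).inner measurable_fst
      fun_prop
    · exact Filter.Eventually.of_forall fun p => (norm_exp_neg_I_mul _).le
  have e1 : ∀ y, k y * ψ y =
      ∫ ω, Complex.exp (-Complex.I * (inner ℝ (η ω) y : ℝ)) * (k y * F ω) ∂ν := fun y => by
    rw [hψ, ← integral_const_mul]
    congr 1 with ω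
    ring
  simp_rw [e1]
  rw [integral_integral_swap hint]
  congr 1 with ω
  rw [angularFourier_apply, ← integral_mul_const]
  congr 1 with y
  ring

/-- A bounded continuous function is the pointwise limit of a bounded sequence of test functions. -/
theorem exists_schwartz_tendsto {b : Space d → ℂ} (hb : Continuous b) {M : ℝ}
    (hM : ∀ ξ, ‖b ξ‖ ≤ M) :
    ∃ k : ℕ → 𝓢(Space d, ℂ), (∀ m ξ, ‖k m ξ‖ ≤ M + 1) ∧
      ∀ ξ, Filter.Tendsto (fun m => k m ξ) Filter.atTop (nhds (b ξ)) := by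
  have h : ∀ m : ℕ, ∃ g : 𝓢(Space d, ℂ), ∀ ξ,
      dist (g ξ) (((ContDiffBump.mk (c := (0 : Space d)) (m + 1) (m + 2) (by positivity)
        (by linarith) : ContDiffBump (0 : Space d)) ξ : ℂ) * b ξ) < 1 / ((m : ℝ) + 1) := by
    intro m
    set χ : ContDiffBump (0 : Space d) :=
      ContDiffBump.mk (m + 1) (m + 2) (by positivity) (by linarith)
    obtain ⟨g, hg, hd, hs⟩ := Continuous.exists_contDiff_approx (E := Space d)
      (f := fun ξ => ((χ ξ : ℝ) : ℂ) * b ξ) (ε := fun _ => 1 / ((m : ℝ) + 1)) ⊤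
      -- The cutoff χ is 1 on the ball of radius m + 1. The smooth approximant keeps its support
      -- inside that of χ b, hence is a test function.
      ((Complex.continuous_ofReal.comp χ.continuous).mul hb) continuous_const
      (fun _ => by positivity)
    have hc : HasCompactSupport g := by
      refine HasCompactSupport.mono χ.hasCompactSupport (hs.trans ?_)
      intro ξ hξ
      simp only [Function.mem_support, ne_eq, mul_eq_zero, not_or, Complex.ofReal_eq_zero] at hξ ⊢
      exact hξ.1
    exact ⟨hc.toSchwartzMap hg, hd⟩
  choose k hk using h
  refine ⟨k, fun m ξ => ?_, fun ξ => ?_⟩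
  · have h1 := (hk m ξ).le
    rw [dist_eq_norm] at h1
    have h2 := norm_le_norm_add_norm_sub' (k m ξ) (((ContDiffBump.mk (c := (0 : Space d)) (m + 1)
      (m + 2) (by positivity) (by linarith) : ContDiffBump (0 : Space d)) ξ : ℂ) * b ξ)
    have h3 : (1 : ℝ) / (m + 1) ≤ 1 := by
      rw [div_le_one (by positivity)]; linarith [(Nat.cast_nonneg m : (0 : ℝ) ≤ m)]
    have h4 : ‖(((ContDiffBump.mk (c := (0 : Space d)) (m + 1)
      (m + 2) (by positivity) (by linarith) : ContDiffBump (0 : Space d)) ξ : ℂ) * b ξ)‖ ≤ M := by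
      rw [norm_mul, Complex.norm_real, Real.norm_of_nonneg (ContDiffBump.nonneg _)]
      exact (mul_le_of_le_one_left (norm_nonneg _) (ContDiffBump.le_one _)).trans (hM ξ)
    linarith
  · rw [tendsto_iff_dist_tendsto_zero]
    refine squeeze_zero' (Filter.Eventually.of_forall fun _ => dist_nonneg) ?_
      tendsto_one_div_add_atTop_nhds_zero_nat
    filter_upwards [Filter.eventually_ge_atTop ⌈‖ξ‖⌉₊] with m hm
    have h1 := (hk m ξ).le
    rwa [ContDiffBump.one_of_mem_closedBall, Complex.ofReal_one, one_mul] at h1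
    rw [mem_closedBall_zero_iff]
    show ‖ξ‖ ≤ m + 1
    have := (Nat.le_ceil ‖ξ‖).trans (Nat.cast_le.2 hm)
    linarith

/-- The inverse transform of ψ, as a density, is the image of F dν under η. Testing against Schwartz
functions shows this by duality; bounded continuous b, such as the wave symbol, follow by dominated
convergence. -/
theorem integral_mul_angularFourierInv {η : V → Space d} (hη : Measurable η)
    {F : V → ℂ} (hF : Integrable F ν) {ψ : 𝓢(Space d, ℂ)}
    (hψ : ∀ y, ψ y = ∫ ω, Complex.exp (-Complex.I * (inner ℝ (η ω) y : ℝ)) * F ω ∂ν)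
    {b : Space d → ℂ} (hb : Continuous b) {M : ℝ} (hM : ∀ ξ, ‖b ξ‖ ≤ M) :
    ∫ ξ, b ξ * angularFourierInv d ψ ξ = ∫ ω, b (η ω) * F ω ∂ν := by
  have key : ∀ k : 𝓢(Space d, ℂ),
      ∫ ξ, k ξ * angularFourierInv d ψ ξ = ∫ ω, k (η ω) * F ω ∂ν := by
    intro k
    -- Two representations of ψ as a Fourier integral, the given one and Fourier inversion, are
    -- paired with the same function.
    have h1 := integral_mul_eq_integral_angularFourier_mul hη hF hψ (angularFourierInv d k)
    have h2 := integral_mul_eq_integral_angularFourier_mul (V := Space d) (ν := volume)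
      (η := id) measurable_id (angularFourierInv d ψ).integrable (ψ := ψ)
      (fun y => by
        conv_lhs => rw [← angularFourier_angularFourierInv ψ, angularFourier_apply]
        simp only [id, real_inner_comm]) (angularFourierInv d k)
    rw [angularFourier_angularFourierInv] at h1 h2
    exact h2.symm.trans h1
  obtain ⟨k, hk, hlim⟩ := exists_schwartz_tendsto hb hM
  refine tendsto_nhds_unique (f := fun m => ∫ ξ, k m ξ * angularFourierInv d ψ ξ)
    (l := Filter.atTop) ?_ ?_
  · refine tendsto_integral_of_dominated_convergence
      (fun ξ => (M + 1) * ‖angularFourierInv d ψ ξ‖) (fun m => ?_)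
      ((angularFourierInv d ψ).integrable.norm.const_mul _)
      (fun m => Filter.Eventually.of_forall fun ξ => ?_)
      (Filter.Eventually.of_forall fun ξ => (hlim ξ).mul_const _)
    · exact ((k m).continuous.mul (angularFourierInv d ψ).continuous).aestronglyMeasurable
    · rw [norm_mul]
      exact mul_le_mul_of_nonneg_right (hk m ξ) (norm_nonneg _)
  · simp_rw [key]
    refine tendsto_integral_of_dominated_convergence
      (fun ω => (M + 1) * ‖F ω‖) (fun m => ?_) (hF.norm.const_mul _)
      (fun m => Filter.Eventually.of_forall fun ω => ?_)
      (Filter.Eventually.of_forall fun ω => (hlim _).mul_const _)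
    · exact ((k m).continuous.measurable.comp hη).aestronglyMeasurable.mul hF.1
    · rw [norm_mul]
      exact mul_le_mul_of_nonneg_right (hk m _) (norm_nonneg _)

theorem continuous_waveSymbol (s : ℝ) : Continuous (waveSymbol s : Space d → ℂ) := by
  unfold waveSymbol
  exact Complex.continuous_ofReal.comp
    (continuous_const.mul (Real.continuous_sinc.comp (continuous_const.mul continuous_norm)))

theorem norm_waveSymbol_le (s : ℝ) (ξ : Space d) : ‖waveSymbol s ξ‖ ≤ |s| := by
  rw [waveSymbol, Complex.norm_real, Real.norm_eq_abs, abs_mul]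
  exact mul_le_of_le_one_right (abs_nonneg _) (Real.abs_sinc_le_one _)

theorem waveSymbol_neg (s : ℝ) (ξ : Space d) : waveSymbol s (-ξ) = waveSymbol s ξ := by
  simp [waveSymbol]

/-- Convolution with G(s, ·) multiplies the amplitude by the symbol at the frequency η. -/
theorem conv_waveG {η : V → Space d} (hη : Measurable η)
    {F : V → ℂ} (hF : Integrable F ν) {ψ : 𝓢(Space d, ℂ)}
    (hψ : ∀ y, ψ y = ∫ ω, Complex.exp (-Complex.I * (inner ℝ (η ω) y : ℝ)) * F ω ∂ν)
    (s : ℝ) (x : Space d) :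
    conv ψ (waveG d s) x =
      ∫ ω, Complex.exp (-Complex.I * (inner ℝ (η ω) x : ℝ)) * (waveSymbol s (η ω) * F ω) ∂ν := by
  set ψx := compSubConstCLM ℂ x (compCLMOfContinuousLinearEquiv ℂ (ContinuousLinearEquiv.neg ℝ) ψ)
    with hψx
  have h1 : ∀ y, ψx y = ψ (x - y) := fun y => by simp [hψx]
  have hG : Integrable
      (fun ω => Complex.exp (-Complex.I * (inner ℝ (η ω) x : ℝ)) * F ω) ν := by
    refine hF.bdd_mul (c := 1) ?_ (Filter.Eventually.of_forall fun p => (norm_exp_neg_I_mul _).le)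
    have : Measurable fun ω => (inner ℝ (η ω) x : ℝ) := hη.inner measurable_const
    exact Measurable.aestronglyMeasurable (by fun_prop)
  -- Reflection turns η into -η, which the even symbol does not see; translation by x contributes
  -- the phase.
  have h2 : ∀ y, ψx y = ∫ ω, Complex.exp (-Complex.I * (inner ℝ ((-η) ω) y : ℝ)) *
      (Complex.exp (-Complex.I * (inner ℝ (η ω) x : ℝ)) * F ω) ∂ν := fun y => by
    rw [h1, hψ]
    congr 1 with ω
    rw [← mul_assoc, ← Complex.exp_add, inner_sub_right, Pi.neg_apply, inner_neg_left]
    congr 2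
    push_cast
    ring
  have h3 := integral_mul_angularFourierInv hη.neg hG h2 (continuous_waveSymbol s)
    (norm_waveSymbol_le s)
  have h4 := waveG_angularFourier s (angularFourierInv d ψx)
  rw [angularFourier_angularFourierInv] at h4
  show waveG d s ψx = _
  rw [h4, h3]
  congr 1 with ω
  rw [Pi.neg_apply, waveSymbol_neg]
  ring

end Duality

/-! ### The Fourier transform of the kernel at fixed times -/

section Multiplier

variable {d n : ℕ}

/-- The product `∏ⱼ sin(sⱼ|ξ₁ + ⋯ + ξⱼ|)/|ξ₁ + ⋯ + ξⱼ|`. -/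
def waveMult : (n : ℕ) → (Fin n → ℝ) → (Fin n → Space d) → ℂ
  | 0, _, _ => 1
  | n + 1, s, ξ => waveMult n (Fin.init s) (Fin.init ξ) * waveSymbol (s (Fin.last n)) (∑ i, ξ i)

theorem continuous_uncurry_waveSymbol :
    Continuous fun p : ℝ × Space d => waveSymbol p.1 p.2 := by
  unfold waveSymbol
  exact Complex.continuous_ofReal.comp (continuous_fst.mul
    (Real.continuous_sinc.comp (continuous_fst.mul continuous_snd.norm)))

theorem continuous_uncurry_waveMult (n : ℕ) :
    Continuous fun p : (Fin n → ℝ) × (Fin n → Space d) => waveMult n p.1 p.2 := by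
  induction n with
  | zero => exact continuous_const
  | succ n ih =>
    simp only [waveMult]
    refine Continuous.mul ?_ ?_
    · refine ih.comp (f := fun p : (Fin (n + 1) → ℝ) × (Fin (n + 1) → Space d) =>
        ((Fin.init p.1 : Fin n → ℝ), (Fin.init p.2 : Fin n → Space d))) ?_
      unfold Fin.init
      fun_prop
    · exact continuous_uncurry_waveSymbol.comp (f := fun p :
        (Fin (n + 1) → ℝ) × (Fin (n + 1) → Space d) => (p.1 (Fin.last n), ∑ i, p.2 i))
        (by fun_prop)

theorem continuous_waveMult (s : Fin n → ℝ) :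
    Continuous (waveMult n s : (Fin n → Space d) → ℂ) :=
  (continuous_uncurry_waveMult n).comp (Continuous.prodMk_right s)

theorem norm_waveMult_le (n : ℕ) (s : Fin n → ℝ) (ξ : Fin n → Space d) :
    ‖waveMult n s ξ‖ ≤ ∏ j, |s j| := by
  induction n with
  | zero => simp [waveMult]
  | succ n ih =>
    rw [waveMult, norm_mul, Fin.prod_univ_castSucc]
    exact mul_le_mul (ih _ _) (norm_waveSymbol_le _ _) (norm_nonneg _)
      (Finset.prod_nonneg fun _ _ => abs_nonneg _)

theorem integrable_one_add_norm_pow_mul (f : 𝓢(Space d, ℂ)) (k : ℕ) :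
    Integrable fun ξ => (1 + ‖ξ‖) ^ k * ‖f ξ‖ := by
  have h : ∀ ξ : Space d, (1 + ‖ξ‖) ^ k * ‖f ξ‖ =
      ∑ m ∈ Finset.range (k + 1), (k.choose m : ℝ) * (‖ξ‖ ^ m * ‖f ξ‖) := fun ξ => by
    rw [add_comm, add_pow, Finset.sum_mul]
    exact Finset.sum_congr rfl fun m _ => by ring
  simp_rw [h]
  exact integrable_finsetSum _ fun m _ => (f.integrable_pow_mul volume m).const_mul _

/-- A product of Schwartz functions in separate variables has integrable moments. -/
theorem integrable_norm_pow_mul_prod (h : Fin n → 𝓢(Space d, ℂ)) (k : ℕ) :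
    Integrable fun ξ : Fin n → Space d => ‖ξ‖ ^ k * ‖∏ j, h j (ξ j)‖ := by
  refine (Integrable.fintype_prod (μ := fun _ => volume)
    (fun j => integrable_one_add_norm_pow_mul (h j) k)).mono' ?_
    (Filter.Eventually.of_forall fun ξ => ?_)
  · refine Continuous.aestronglyMeasurable ?_
    have : ∀ j, Continuous (h j) := fun j => (h j).continuous
    fun_prop
  · rw [Real.norm_of_nonneg (by positivity), Finset.prod_mul_distrib, norm_prod,
      Finset.prod_pow]
    refine mul_le_mul_of_nonneg_right (pow_le_pow_left₀ (norm_nonneg _) ?_ _) (by positivity)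
    -- The sup norm of ξ is at most ∏ⱼ (1 + |ξⱼ|), which reduces the moments to one-variable ones.
    refine (pi_norm_le_iff_of_nonneg (by positivity)).2 fun j => ?_
    rw [← Finset.mul_prod_erase _ _ (Finset.mem_univ j)]
    have h1 : (1 : ℝ) ≤ ∏ i ∈ Finset.univ.erase j, (1 + ‖ξ i‖) :=
      Finset.one_le_prod fun i _ => by linarith [norm_nonneg (ξ i)]
    nlinarith [norm_nonneg (ξ j)]

theorem integrable_norm_pow_mul_waveMult (s : Fin n → ℝ) (h : Fin n → 𝓢(Space d, ℂ)) (k : ℕ) :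
    Integrable fun ξ : Fin n → Space d => ‖ξ‖ ^ k * ‖waveMult n s ξ * ∏ j, h j (ξ j)‖ := by
  refine ((integrable_norm_pow_mul_prod h k).const_mul (∏ j, |s j|)).mono' ?_
    (Filter.Eventually.of_forall fun ξ => ?_)
  · refine Continuous.aestronglyMeasurable ?_
    have : ∀ j, Continuous (h j) := fun j => (h j).continuous
    have := continuous_waveMult (d := d) s
    fun_prop
  · rw [Real.norm_of_nonneg (by positivity), norm_mul, mul_left_comm]
    exact mul_le_mul_of_nonneg_right (norm_waveMult_le n s ξ) (by positivity)

theorem integrable_waveMult (s : Fin n → ℝ) (h : Fin n → 𝓢(Space d, ℂ)) :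
    Integrable fun ξ : Fin n → Space d => waveMult n s ξ * ∏ j, h j (ξ j) := by
  have h1 := integrable_norm_pow_mul_waveMult s h 0
  simp only [pow_zero, one_mul] at h1
  refine (integrable_norm_iff ?_).1 h1
  refine Continuous.aestronglyMeasurable ?_
  have : ∀ j, Continuous (h j) := fun j => (h j).continuous
  have := continuous_waveMult (d := d) s
  fun_prop

/-- The Fourier integral, along a linear map, of a function with integrable moments is of temperate
growth. -/
theorem hasTemperateGrowth_fourierIntegral {V W : Type*} [NormedAddCommGroup V] [NormedSpace ℝ V]
    [MeasurableSpace V] [BorelSpace V] [SecondCountableTopology V] [NormedAddCommGroup W]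
    [NormedSpace ℝ W] {ν : Measure V} (L : V →L[ℝ] W →L[ℝ] ℝ) {F : V → ℂ}
    (hF : AEStronglyMeasurable F ν) (hm : ∀ k : ℕ, Integrable (fun v => ‖v‖ ^ k * ‖F v‖) ν) :
    Function.HasTemperateGrowth
      (VectorFourier.fourierIntegral Real.fourierChar ν L.toLinearMap₁₂ F) := by
  -- Growth exponent 0: every derivative is bounded, by a moment of F.
  refine ⟨VectorFourier.contDiff_fourierIntegral L (N := ⊤) fun k _ => hm k, fun k => ⟨0,
    ∫ v, (2 * π * ‖L‖) ^ k * (‖v‖ ^ k * ‖F v‖) ∂ν, fun w => ?_⟩⟩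
  rw [VectorFourier.iteratedFDeriv_fourierIntegral L (N := ⊤) (fun k _ => hm k) hF le_top,
    pow_zero, mul_one]
  refine (VectorFourier.norm_fourierIntegral_le_integral_norm _ _ _ _ _).trans ?_
  refine integral_mono_of_nonneg (Filter.Eventually.of_forall fun _ => norm_nonneg _)
    ((hm k).const_mul _) (Filter.Eventually.of_forall fun v => ?_)
  refine (VectorFourier.norm_fourierPowSMulRight_le L F v k).trans_eq ?_
  ring

/-- The pairing `(ξ, x) ↦ (2π)⁻¹ (ξ₁ + ⋯ + ξₙ) · x`. -/
def sumPairing (d n : ℕ) : (Fin n → Space d) →L[ℝ] Space d →L[ℝ] ℝ :=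
  (2 * π)⁻¹ • (innerSL ℝ).comp (∑ i, ContinuousLinearMap.proj i)

theorem hasTemperateGrowth_integral_exp {F : (Fin n → Space d) → ℂ}
    (hF : AEStronglyMeasurable F volume)
    (hm : ∀ k : ℕ, Integrable fun ξ => ‖ξ‖ ^ k * ‖F ξ‖) :
    Function.HasTemperateGrowth fun x : Space d =>
      ∫ ξ, Complex.exp (-Complex.I * (inner ℝ (∑ i, ξ i) x : ℝ)) * F ξ := by
  convert hasTemperateGrowth_fourierIntegral (sumPairing d n) hF hm using 2 with x
  rw [VectorFourier.fourierIntegral]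
  congr 1 with ξ
  rw [Circle.smul_def, Real.fourierChar_apply, smul_eq_mul]
  congr 2
  simp only [sumPairing, ContinuousLinearMap.toLinearMap₁₂_apply]
  simp
  have : (π : ℂ) ≠ 0 := by exact_mod_cast Real.pi_ne_zero
  field_simp
  rw [sum_inner]
  push_cast
  rfl

/-- Induction on n: multiplying by the next test function adds its frequency to the sum, and
`conv_waveG` supplies the next factor of `waveMult`. -/
theorem iteratedConv_angularFourier (n : ℕ) (h : Fin n → 𝓢(Space d, ℂ)) (s : Fin n → ℝ)
    (x : Space d) :
    iteratedConv n (fun j => angularFourier d (h j)) s x =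
      ∫ ξ : Fin n → Space d, Complex.exp (-Complex.I * (inner ℝ (∑ i, ξ i) x : ℝ)) *
        (waveMult n s ξ * ∏ j, h j (ξ j)) := by
  induction n generalizing x with
  | zero =>
    simp [iteratedConv, waveMult, measureReal_def, volume_pi]
  | succ n ih =>
    set h' : Fin n → 𝓢(Space d, ℂ) := fun j => h j.castSucc with hh'
    set Φ := iteratedConv n (fun j => angularFourier d (h' j)) (Fin.init s) with hΦ
    have hΦe : Φ = fun x : Space d => ∫ ξ : Fin n → Space d,
        Complex.exp (-Complex.I * (inner ℝ (∑ i, ξ i) x : ℝ)) *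
        (waveMult n (Fin.init s) ξ * ∏ j, h' j (ξ j)) := funext fun x => ih h' (Fin.init s) x
    -- Needed for `smulLeftCLM` to be the actual product with Φ.
    have hT : Function.HasTemperateGrowth Φ := by
      rw [hΦe]
      exact hasTemperateGrowth_integral_exp (integrable_waveMult _ _).1
        fun k => integrable_norm_pow_mul_waveMult _ _ k
    have hF : Integrable (fun p : Space d × (Fin n → Space d) =>
        h (Fin.last n) p.1 * (waveMult n (Fin.init s) p.2 * ∏ j, h' j (p.2 j)))
        (volume.prod volume) :=
      (h (Fin.last n)).integrable.mul_prod (integrable_waveMult (Fin.init s) h')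
    have hη : Measurable fun p : Space d × (Fin n → Space d) => p.1 + ∑ i, p.2 i := by fun_prop
    have hψ : ∀ y, smulLeftCLM ℂ Φ (angularFourier d (h (Fin.last n))) y =
        ∫ p : Space d × (Fin n → Space d),
          Complex.exp (-Complex.I * (inner ℝ (p.1 + ∑ i, p.2 i) y : ℝ)) *
          (h (Fin.last n) p.1 * (waveMult n (Fin.init s) p.2 * ∏ j, h' j (p.2 j)))
          ∂(volume.prod volume) := by
      intro y
      rw [smulLeftCLM_apply_apply hT, hΦe, angularFourier_apply, smul_eq_mul, mul_comm,
        ← integral_prod_mul]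
      congr 1 with p
      rw [inner_add_left, real_inner_comm y]
      push_cast
      rw [mul_add, Complex.exp_add, real_inner_comm]
      ring
    show conv (smulLeftCLM ℂ Φ (angularFourier d (h (Fin.last n)))) (waveG d (s (Fin.last n))) x = _
    rw [conv_waveG hη hF hψ]
    have hmp : MeasurePreserving
        (fun p : Space d × (Fin n → Space d) => (Fin.snoc p.2 p.1 : Fin (n + 1) → Space d))
        (volume.prod volume) volume := measurePreserving_snoc volume
    rw [← hmp.integral_comp measurableEmbedding_snoc]
    congr 1 with p
    have e1 : ∑ i, (Fin.snoc p.2 p.1 : Fin (n + 1) → Space d) i = p.1 + ∑ i, p.2 i := by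
      rw [Fin.sum_univ_castSucc]; simp [add_comm]
    rw [e1, waveMult, Fin.init_snoc, e1, Fin.prod_univ_castSucc]
    simp only [Fin.snoc_castSucc, Fin.snoc_last, hh']
    ring

end Multiplier

/-! ### Uniqueness of the Fourier transform as a function -/

section Uniqueness

variable {d n : ℕ}

/-- A smooth bump function as a complex Schwartz function. -/
def bumpSchwartz {c : Space d} (χ : ContDiffBump c) : 𝓢(Space d, ℂ) :=
  HasCompactSupport.toSchwartzMap (f := fun ξ => ((χ ξ : ℝ) : ℂ))
    (χ.hasCompactSupport.comp_left (g := fun r : ℝ => (r : ℂ)) Complex.ofReal_zero)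
    (Complex.ofRealCLM.contDiff.comp χ.contDiff)

theorem bumpSchwartz_apply {c : Space d} (χ : ContDiffBump c) (ξ : Space d) :
    bumpSchwartz χ ξ = ((χ ξ : ℝ) : ℂ) := rfl

/-- A bump equal to `1` on the closed ball of radius `r`, supported in the one of radius
`r + 1 / (m + 1)`. -/
def shrinkingBump (c : Space d) (r : ℝ) (hr : 0 < r) (m : ℕ) : ContDiffBump c :=
  ⟨r, r + 1 / ((m : ℝ) + 1), hr, by simp; positivity⟩

theorem prod_shrinkingBump_eq_one {v ξ : Fin n → Space d} {r : ℝ} (hr : 0 < r) (m : ℕ)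
    (h : ξ ∈ Metric.closedBall v r) :
    ∏ j, bumpSchwartz (shrinkingBump (v j) r hr m) (ξ j) = 1 := by
  refine Finset.prod_eq_one fun j _ => ?_
  rw [bumpSchwartz_apply, ContDiffBump.one_of_mem_closedBall, Complex.ofReal_one]
  exact (dist_pi_le_iff hr.le).1 h j

theorem prod_shrinkingBump_eq_zero {v ξ : Fin n → Space d} {r : ℝ} (hr : 0 < r) (m : ℕ)
    (h : r + 1 / ((m : ℝ) + 1) < dist ξ v) :
    ∏ j, bumpSchwartz (shrinkingBump (v j) r hr m) (ξ j) = 0 := by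
  have : ∃ j, r + 1 / ((m : ℝ) + 1) < dist (ξ j) (v j) := by
    by_contra! hc
    exact absurd ((dist_pi_le_iff (by positivity)).2 hc) (not_le.2 h)
  obtain ⟨j, hj⟩ := this
  refine Finset.prod_eq_zero (Finset.mem_univ j) ?_
  rw [bumpSchwartz_apply, ContDiffBump.zero_of_le_dist _ hj.le, Complex.ofReal_zero]

theorem norm_prod_shrinkingBump_le (v ξ : Fin n → Space d) {r : ℝ} (hr : 0 < r) (m : ℕ) :
    ‖∏ j, bumpSchwartz (shrinkingBump (v j) r hr m) (ξ j)‖ ≤ 1 := by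
  rw [norm_prod]
  refine Finset.prod_le_one (fun _ _ => norm_nonneg _) fun j _ => ?_
  rw [bumpSchwartz_apply, Complex.norm_real, Real.norm_of_nonneg (ContDiffBump.nonneg _)]
  exact ContDiffBump.le_one _

/-- Closed balls for the sup metric are products of balls, so tensor products of bumps decrease to
their indicators. Hence F integrates to zero over every ball, and Lebesgue differentiation
concludes. -/
theorem ae_eq_zero_of_integral_prod_schwartz_eq_zero {F : (Fin n → Space d) → ℂ}
    (hF : ∀ h : Fin n → 𝓢(Space d, ℂ),
      Integrable (fun ξ : Fin n → Space d => F ξ * ∏ j, h j (ξ j)) ∧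
        ∫ ξ : Fin n → Space d, F ξ * ∏ j, h j (ξ j) = 0) :
    F =ᵐ[volume] 0 := by
  have hball : ∀ (v : Fin n → Space d) (r : ℝ), 0 < r →
      IntegrableOn F (Metric.closedBall v r) := by
    intro v r hr
    refine ((hF fun j => bumpSchwartz (shrinkingBump (v j) r hr 0)).1.integrableOn
      (s := Metric.closedBall v r)).congr_fun (fun ξ hξ => ?_) measurableSet_closedBall
    simp only [prod_shrinkingBump_eq_one hr 0 hξ, mul_one]
  have hzero : ∀ (v : Fin n → Space d) (r : ℝ), 0 < r →
      ∫ ξ in Metric.closedBall v r, F ξ = 0 := by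
    intro v r hr
    rw [← integral_indicator measurableSet_closedBall]
    refine tendsto_nhds_unique (l := Filter.atTop)
      (f := fun m : ℕ => ∫ ξ, F ξ * ∏ j, bumpSchwartz (shrinkingBump (v j) r hr m) (ξ j)) ?_ ?_
    · refine tendsto_integral_of_dominated_convergence
        ((Metric.closedBall v (r + 1)).indicator fun ξ => ‖F ξ‖) (fun m => (hF _).1.1)
        ((integrable_indicator_iff measurableSet_closedBall).2
          (Integrable.norm (hball v (r + 1) (by linarith))))
        (fun m => Filter.Eventually.of_forall fun ξ => ?_)
        (Filter.Eventually.of_forall fun ξ => ?_)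
      · by_cases h : ξ ∈ Metric.closedBall v (r + 1)
        · rw [Set.indicator_of_mem h, norm_mul]
          exact mul_le_of_le_one_right (norm_nonneg _) (norm_prod_shrinkingBump_le v ξ hr m)
        · rw [Set.indicator_of_notMem h, prod_shrinkingBump_eq_zero, mul_zero, norm_zero]
          rw [Metric.mem_closedBall, not_le] at h
          have : (1 : ℝ) / (m + 1) ≤ 1 := by
            rw [div_le_one (by positivity)]; linarith [(Nat.cast_nonneg m : (0 : ℝ) ≤ m)]
          linarith
      · by_cases h : ξ ∈ Metric.closedBall v r
        · simp only [Set.indicator_of_mem h, prod_shrinkingBump_eq_one hr _ h, mul_one]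
          exact tendsto_const_nhds
        · rw [Set.indicator_of_notMem h]
          refine tendsto_const_nhds.congr' ?_
          rw [Metric.mem_closedBall, not_le] at h
          filter_upwards [(tendsto_one_div_add_atTop_nhds_zero_nat (𝕜 := ℝ)).eventually
            (gt_mem_nhds (sub_pos.2 h))] with m hm
          rw [prod_shrinkingBump_eq_zero hr m (by linarith), mul_zero]
    · simp only [(hF _).2]
      exact tendsto_const_nhds
  have hloc : LocallyIntegrable F := fun v =>
    ⟨Metric.closedBall v 1, Metric.closedBall_mem_nhds v one_pos, hball v 1 one_pos⟩
  filter_upwards [IsUnifLocDoublingMeasure.ae_tendsto_average volume hloc 1] with ξ hξ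
  have h1 := hξ (l := Filter.atTop) (fun _ : ℕ => ξ) (fun m => 1 / ((m : ℝ) + 1))
    (tendsto_nhdsWithin_iff.2 ⟨tendsto_one_div_add_atTop_nhds_zero_nat,
      Filter.Eventually.of_forall fun m => by simp only [Set.mem_Ioi]; positivity⟩)
    (Filter.Eventually.of_forall fun m => Metric.mem_closedBall_self (by positivity))
  refine tendsto_nhds_unique h1 (tendsto_const_nhds.congr fun m => ?_)
  rw [setAverage_eq, hzero _ _ (by positivity), smul_zero]
  rfl

theorem IsFourierFunction.ae_eq {T : TensorAction d n} {K K' : (Fin n → Space d) → ℂ}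
    (hK : IsFourierFunction T K) (hK' : IsFourierFunction T K') : K =ᵐ[volume] K' := by
  have : K - K' =ᵐ[volume] 0 := by
    refine ae_eq_zero_of_integral_prod_schwartz_eq_zero fun h => ?_
    simp only [Pi.sub_apply, sub_mul]
    refine ⟨(hK.2 h).1.sub (hK'.2 h).1, ?_⟩
    rw [integral_sub (hK.2 h).1 (hK'.2 h).1, ← (hK.2 h).2, ← (hK'.2 h).2, sub_self]
  filter_upwards [this] with ξ hξ
  exact sub_eq_zero.1 hξ

theorem IsFourierFunction.fourierFunction_ae_eq {T : TensorAction d n}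
    {K : (Fin n → Space d) → ℂ} (hK : IsFourierFunction T K) :
    fourierFunction T =ᵐ[volume] K := by
  have h : ∃ K, IsFourierFunction T K := ⟨K, hK⟩
  rw [fourierFunction, dif_pos h]
  exact h.choose_spec.ae_eq hK

theorem pi_absolutelyContinuous {X : Type*} [MeasurableSpace X] {μ ν : Measure X}
    [SigmaFinite μ] [SigmaFinite ν] (h : μ ≪ ν) (n : ℕ) :
    (Measure.pi fun _ : Fin n => μ) ≪ Measure.pi fun _ => ν := by
  induction n with
  | zero => rw [Measure.pi_of_empty (fun _ : Fin 0 => μ) default,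
      Measure.pi_of_empty (fun _ : Fin 0 => ν) default]
  | succ n ih =>
    rw [← (measurePreserving_snoc μ).map_eq, ← (measurePreserving_snoc ν).map_eq]
    exact (h.prod ih).map measurableEmbedding_snoc.measurable

instance sigmaFinite_rieszMeasure (α : ℝ) : SigmaFinite (rieszMeasure d α) := by
  unfold rieszMeasure; infer_instance

/-- Carries identities that hold Lebesgue-almost everywhere over to the spectral measure. -/
theorem rieszMeasure_pi_absolutelyContinuous (α : ℝ) (n : ℕ) :
    (Measure.pi fun _ : Fin n => rieszMeasure d α) ≪ (volume : Measure (Fin n → Space d)) :=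
  pi_absolutelyContinuous (withDensity_absolutelyContinuous _ _) n

end Uniqueness

/-! ### Symmetrization on the Fourier side -/

section Symmetrization

variable {d n : ℕ}

theorem measurePreserving_comp_perm {X : Type*} [MeasurableSpace X] (μ : Measure X)
    [SigmaFinite μ] (ρ : Equiv.Perm (Fin n)) :
    MeasurePreserving (fun ξ : Fin n → X => ξ ∘ ρ) (Measure.pi fun _ => μ)
      (Measure.pi fun _ => μ) := by
  convert measurePreserving_piCongrLeft (fun _ : Fin n => μ) ρ.symm using 1
  ext ξ j
  obtain ⟨i, rfl⟩ := ρ.symm.surjective j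
  rw [MeasurableEquiv.coe_piCongrLeft, Equiv.piCongrLeft_apply_apply]
  simp

theorem measurableEmbedding_comp_perm {X : Type*} [MeasurableSpace X] (ρ : Equiv.Perm (Fin n)) :
    MeasurableEmbedding fun ξ : Fin n → X => ξ ∘ ρ := by
  convert (MeasurableEquiv.piCongrLeft (fun _ : Fin n => X) ρ.symm).measurableEmbedding using 1
  ext ξ j
  obtain ⟨i, rfl⟩ := ρ.symm.surjective j
  rw [MeasurableEquiv.coe_piCongrLeft, Equiv.piCongrLeft_apply_apply]
  simp

/-- The symmetrization of a function of times and frequencies. -/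
def symmetrizeFun (K : (Fin n → ℝ) → (Fin n → Space d) → ℂ) (τ : Fin n → ℝ)
    (ξ : Fin n → Space d) : ℂ :=
  (n.factorial : ℂ)⁻¹ * ∑ ρ : Equiv.Perm (Fin n), K (τ ∘ ρ) (ξ ∘ ρ)

/-- Permuting test functions amounts to the measure-preserving change of variables ξ ↦ ξ ∘ ρ. -/
theorem IsFourierFunction.symmetrize {f : (Fin n → ℝ) → TensorAction d n}
    {K : (Fin n → ℝ) → (Fin n → Space d) → ℂ} (hK : ∀ τ, IsFourierFunction (f τ) (K τ))
    (τ : Fin n → ℝ) :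
    IsFourierFunction (FractionalWave.symmetrize f τ) (symmetrizeFun K τ) := by
  have hmp : ∀ ρ : Equiv.Perm (Fin n), MeasurePreserving (fun ξ : Fin n → Space d => ξ ∘ ρ)
      volume volume := fun ρ => measurePreserving_comp_perm volume ρ
  have hprod : ∀ (h : Fin n → 𝓢(Space d, ℂ)) (ρ : Equiv.Perm (Fin n)) (ξ : Fin n → Space d),
      ∏ j, (h ∘ ρ) j ((ξ ∘ ρ) j) = ∏ j, h j (ξ j) := fun h ρ ξ =>
    Equiv.prod_comp ρ fun j => h j (ξ j)
  have hint : ∀ (h : Fin n → 𝓢(Space d, ℂ)) (ρ : Equiv.Perm (Fin n)),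
      Integrable (fun ξ : Fin n → Space d => K (τ ∘ ρ) (ξ ∘ ρ) * ∏ j, h j (ξ j)) ∧
      f (τ ∘ ρ) ((fun j => angularFourier d (h j)) ∘ ρ) =
        ∫ ξ : Fin n → Space d, K (τ ∘ ρ) (ξ ∘ ρ) * ∏ j, h j (ξ j) := by
    intro h ρ
    obtain ⟨h1, h2⟩ := (hK (τ ∘ ρ)).2 (h ∘ ρ)
    refine ⟨?_, ?_⟩
    · have := (hmp ρ).integrable_comp_of_integrable h1
      refine this.congr (Filter.Eventually.of_forall fun ξ => ?_)
      exact congrArg _ (hprod h ρ ξ)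
    · rw [← (hmp ρ).integral_comp (measurableEmbedding_comp_perm ρ)] at h2
      simp only [hprod] at h2
      exact h2
  refine ⟨?_, fun h => ?_⟩
  · refine AEStronglyMeasurable.const_mul ?_ _
    refine Finset.aestronglyMeasurable_fun_sum _ fun ρ _ => ?_
    exact (hK _).1.comp_measurePreserving (hmp ρ)
  · simp only [symmetrizeFun, mul_assoc, Finset.sum_mul]
    refine ⟨(integrable_finsetSum _ fun ρ _ => (hint h ρ).1).const_mul _, ?_⟩
    rw [integral_const_mul, integral_finsetSum _ fun ρ _ => (hint h ρ).1]
    simp only [FractionalWave.symmetrize]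
    congr 1
    exact Finset.sum_congr rfl fun ρ _ => (hint h ρ).2

/-- The ordered times `0 < t₁ < ⋯ < tₙ < t`. -/
def orderedTimes (n : ℕ) (t : ℝ) : Set (Fin n → ℝ) :=
  {τ | StrictMono τ ∧ ∀ j, τ j ∈ Set.Ioo 0 t}

/-- The increments `t₂ - t₁, …, tₙ - tₙ₋₁, t - tₙ`. -/
def increments (t : ℝ) (τ : Fin n → ℝ) (j : Fin n) : ℝ :=
  (Fin.snoc τ t : Fin (n + 1) → ℝ) j.succ - τ j

/-- The Fourier transform of `kernel t x τ`. -/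
def kernelFun (t : ℝ) (x : Space d) (τ : Fin n → ℝ) (ξ : Fin n → Space d) : ℂ :=
  (orderedTimes n t).indicator (fun τ => Complex.exp (-Complex.I * (inner ℝ (∑ i, ξ i) x : ℝ)) *
    waveMult n (increments t τ) ξ) τ

theorem isFourierFunction_kernel (t : ℝ) (x : Space d) (τ : Fin n → ℝ) :
    IsFourierFunction (kernel t x τ) (kernelFun t x τ) := by
  by_cases hτ : τ ∈ orderedTimes n t
  · have e1 : kernelFun t x τ = fun ξ => Complex.exp (-Complex.I * (inner ℝ (∑ i, ξ i) x : ℝ)) *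
        waveMult n (increments t τ) ξ := by
      ext ξ; rw [kernelFun, Set.indicator_of_mem hτ]
    have hexp : Continuous fun ξ : Fin n → Space d =>
        Complex.exp (-Complex.I * (inner ℝ (∑ i, ξ i) x : ℝ)) := by fun_prop
    rw [e1]
    refine ⟨(hexp.mul (continuous_waveMult _)).aestronglyMeasurable, fun h => ?_⟩
    simp only [mul_assoc]
    refine ⟨(integrable_waveMult _ h).bdd_mul (c := 1) hexp.aestronglyMeasurable
      (Filter.Eventually.of_forall fun ξ => (norm_exp_neg_I_mul _).le), ?_⟩
    rw [kernel, if_pos (show _ ∧ _ from hτ)]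
    exact iteratedConv_angularFourier n h _ x
  · have e1 : kernelFun t x τ = fun _ : Fin n → Space d => (0 : ℂ) := by
      ext ξ; rw [kernelFun, Set.indicator_of_notMem hτ]
    rw [e1]
    refine ⟨aestronglyMeasurable_const, fun h => ?_⟩
    simp only [zero_mul, integral_zero]
    exact ⟨integrable_zero _ _ _, by rw [kernel, if_neg (show ¬(_ ∧ _) from hτ)]⟩

end Symmetrization

/-! ### Integration over frequencies -/

section SpatialEstimate

variable {d n : ℕ}

/-- In polar coordinates the radial density is at most r^{d-1-α} near 0, integrable since α < d, and
r^{d-3-α} near infinity, integrable since α > d - 2. -/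
theorem integrable_norm_rpow_neg_mul_inv {α : ℝ} (hα_pos : 0 < α) (hα_lt : α < d)
    (hα : (d : ℝ) - 2 < α) :
    Integrable fun ξ : Space d => ‖ξ‖ ^ (-α) * (1 + ‖ξ‖ ^ 2)⁻¹ := by
  have hd : 0 < d := by
    have : (0 : ℝ) < d := hα_pos.trans hα_lt
    exact_mod_cast this
  have : Nonempty (Fin d) := ⟨⟨0, hd⟩⟩
  have : Nontrivial (Space d) := inferInstance
  rw [integrable_fun_norm_addHaar volume (f := fun r : ℝ => r ^ (-α) * (1 + r ^ 2)⁻¹)]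
  rw [finrank_euclideanSpace_fin]
  have hpow : ∀ r : ℝ, 0 < r → r ^ (d - 1) = r ^ ((d : ℝ) - 1) := fun r hr => by
    rw [← Real.rpow_natCast, Nat.cast_sub hd, Nat.cast_one]
  have hmeas : Measurable fun r : ℝ => r ^ (d - 1) • (r ^ (-α) * (1 + r ^ 2)⁻¹) := by
    fun_prop
  rw [← Set.Ioc_union_Ioi_eq_Ioi (zero_le_one' ℝ)]
  refine IntegrableOn.union ?_ ?_
  · have h1 : IntegrableOn (fun r : ℝ => r ^ ((d : ℝ) - 1 - α)) (Set.Ioc 0 1) := by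
      rw [← intervalIntegrable_iff_integrableOn_Ioc_of_le zero_le_one]
      exact intervalIntegral.intervalIntegrable_rpow' (by linarith)
    refine h1.mono' hmeas.aestronglyMeasurable ?_
    refine (ae_restrict_iff' measurableSet_Ioc).2 (Filter.Eventually.of_forall fun r hr => ?_)
    have hr0 : 0 < r := hr.1
    rw [Real.norm_of_nonneg (by positivity), smul_eq_mul, hpow r hr0, ← mul_assoc,
      ← Real.rpow_add hr0]
    refine (mul_le_of_le_one_right (by positivity) ?_).trans_eq (by ring_nf)
    exact inv_le_one_of_one_le₀ (by nlinarith)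
  · have h1 : IntegrableOn (fun r : ℝ => r ^ ((d : ℝ) - 3 - α)) (Set.Ioi 1) :=
      integrableOn_Ioi_rpow_of_lt (by linarith) one_pos
    refine h1.mono' hmeas.aestronglyMeasurable ?_
    refine (ae_restrict_iff' measurableSet_Ioi).2 (Filter.Eventually.of_forall fun r hr => ?_)
    have hr0 : 0 < r := one_pos.trans hr
    rw [Real.norm_of_nonneg (by positivity), smul_eq_mul, hpow r hr0, ← mul_assoc,
      ← Real.rpow_add hr0]
    have h2 : (1 + r ^ 2)⁻¹ ≤ r ^ (-2 : ℝ) := by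
      rw [Real.rpow_neg hr0.le, Real.rpow_two]
      exact inv_anti₀ (by positivity) (by linarith)
    refine (mul_le_mul_of_nonneg_left h2 (by positivity)).trans_eq ?_
    rw [← Real.rpow_add hr0]
    ring_nf

/-- Adds the two bounds |sinc r| ≤ 1 and |r sinc r| ≤ 1 after squaring. -/
theorem norm_waveSymbol_sq_le (u : ℝ) (ξ : Space d) :
    ‖waveSymbol u ξ‖ ^ 2 ≤ 2 * u ^ 2 * (1 + (u * ‖ξ‖) ^ 2)⁻¹ := by
  rw [← div_eq_mul_inv, le_div_iff₀ (by positivity), waveSymbol, Complex.norm_real,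
    Real.norm_eq_abs, sq_abs]
  have h1 : Real.sinc (u * ‖ξ‖) ^ 2 ≤ 1 := by
    rw [← sq_abs]
    exact pow_le_one₀ (abs_nonneg _) (Real.abs_sinc_le_one _)
  have h2 : (Real.sinc (u * ‖ξ‖) * (u * ‖ξ‖)) ^ 2 ≤ 1 := by
    rcases eq_or_ne (u * ‖ξ‖) 0 with h | h
    · simp [h]
    · rw [Real.sinc_of_ne_zero h, div_mul_cancel₀ _ h]
      exact Real.sin_sq_le_one _
  nlinarith [mul_le_mul_of_nonneg_left h1 (sq_nonneg u),
    mul_le_mul_of_nonneg_left h2 (sq_nonneg u)]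

/-- A product of two decreasing functions of `a` and `b` is at most the sum of its values on the
diagonal. -/
theorem rpow_neg_mul_inv_le_add {α : ℝ} (hα : 0 < α) {a b : ℝ} (ha : 0 < a) (hb : 0 < b) (u : ℝ) :
    a ^ (-α) * (1 + (u * b) ^ 2)⁻¹ ≤
      a ^ (-α) * (1 + (u * a) ^ 2)⁻¹ + b ^ (-α) * (1 + (u * b) ^ 2)⁻¹ := by
  rcases le_total a b with h | h
  · refine le_add_of_le_of_nonneg (mul_le_mul_of_nonneg_left ?_ (by positivity)) (by positivity)
    refine inv_anti₀ (by positivity) ?_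
    rw [mul_pow, mul_pow]
    gcongr
  · refine le_add_of_nonneg_of_le (by positivity) (mul_le_mul_of_nonneg_right ?_ (by positivity))
    exact Real.rpow_le_rpow_of_nonpos hb h (by linarith)

/-- Uniformity in η is the point: `rpow_neg_mul_inv_le_add` replaces the product of a weight at ξ
and a decaying factor at ξ + η by a function of ξ plus the same function of ξ + η, and translation
invariance removes η. -/
theorem exists_lintegral_waveSymbol_le {α : ℝ} (hα_pos : 0 < α) (hα_lt : α < d)
    (hα : (d : ℝ) - 2 < α) :
    ∃ C : ℝ, 0 < C ∧ ∀ (u : ℝ) (_ : 0 < u) (η : Space d),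
      ∫⁻ ξ, ‖waveSymbol u (ξ + η)‖ₑ ^ 2 ∂(rieszMeasure d α) ≤
        ENNReal.ofReal (C * u ^ (α - d + 2)) := by
  have hd : 0 < d := by
    have : (0 : ℝ) < d := hα_pos.trans hα_lt
    exact_mod_cast this
  have : Nonempty (Fin d) := ⟨⟨0, hd⟩⟩
  have : Nontrivial (Space d) := inferInstance
  set w : Space d → ℝ := fun ξ => ‖ξ‖ ^ (-α) * (1 + ‖ξ‖ ^ 2)⁻¹ with hw
  have hwi : Integrable w := integrable_norm_rpow_neg_mul_inv hα_pos hα_lt hα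
  have hw0 : ∀ ξ, 0 ≤ w ξ := fun ξ => by positivity
  have hI0 : 0 ≤ ∫ ξ, w ξ := integral_nonneg hw0
  -- The 4 is the 2 of `norm_waveSymbol_sq_le` times the two summands; the 1 only secures
  -- positivity.
  refine ⟨4 * (∫ ξ, w ξ) + 1, by positivity, fun u hu η => ?_⟩
  set W : Space d → ℝ := fun ξ => 2 * u ^ 2 * (‖ξ‖ ^ (-α) * (1 + (u * ‖ξ‖) ^ 2)⁻¹) with hW
  have hW0 : ∀ ξ, 0 ≤ W ξ := fun ξ => by positivity
  -- The dilation by u costs u^{-d}, which leaves u^{α-d+2}.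
  have hWw : ∀ ξ, W ξ = 2 * u ^ (2 + α) * w (u • ξ) := fun ξ => by
    simp only [hW, hw, norm_smul, Real.norm_of_nonneg hu.le]
    rw [Real.mul_rpow hu.le (norm_nonneg _), Real.rpow_add hu, Real.rpow_neg hu.le, Real.rpow_two]
    field_simp
  have hWi : Integrable W := by
    rw [funext hWw]
    exact (hwi.comp_smul hu.ne').const_mul _
  have hWint : ∫ ξ, W ξ = 2 * (∫ ξ, w ξ) * u ^ (α - d + 2) := by
    simp_rw [hWw]
    rw [integral_const_mul, Measure.integral_comp_smul, finrank_euclideanSpace_fin,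
      abs_of_pos (by positivity), smul_eq_mul, show α - d + 2 = (2 + α) - d by ring,
      Real.rpow_sub hu, Real.rpow_natCast]
    field_simp
  have hWl : ∫⁻ ξ, ENNReal.ofReal (W ξ) = ENNReal.ofReal (2 * (∫ ξ, w ξ) * u ^ (α - d + 2)) := by
    rw [← ofReal_integral_eq_lintegral_ofReal hWi (Filter.Eventually.of_forall hW0), hWint]
  have hmS : Measurable fun ξ : Space d => ‖waveSymbol u (ξ + η)‖ₑ ^ 2 := by
    have := (continuous_waveSymbol (d := d) u).measurable
    fun_prop
  rw [rieszMeasure, lintegral_withDensity_eq_lintegral_mul _ (by fun_prop) hmS]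
  have hne : ∀ z : Space d, ∀ᵐ ξ : Space d, ξ ≠ z := fun z => by
    simp [ae_iff]
  simp only [Pi.mul_apply]
  calc ∫⁻ ξ : Space d, ENNReal.ofReal (‖ξ‖ ^ (-α)) * ‖waveSymbol u (ξ + η)‖ₑ ^ 2
      ≤ ∫⁻ ξ, (ENNReal.ofReal (W ξ) + ENNReal.ofReal (W (ξ + η))) := by
        refine lintegral_mono_ae ?_
        filter_upwards [hne 0, hne (-η)] with ξ h1 h2
        have h2' : ξ + η ≠ 0 := fun h => h2 (eq_neg_of_add_eq_zero_left h)
        rw [← ofReal_norm, ← ENNReal.ofReal_pow (norm_nonneg _),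
          ← ENNReal.ofReal_mul (by positivity), ← ENNReal.ofReal_add (hW0 _) (hW0 _)]
        refine ENNReal.ofReal_le_ofReal ?_
        calc ‖ξ‖ ^ (-α) * ‖waveSymbol u (ξ + η)‖ ^ 2
            ≤ ‖ξ‖ ^ (-α) * (2 * u ^ 2 * (1 + (u * ‖ξ + η‖) ^ 2)⁻¹) :=
              mul_le_mul_of_nonneg_left (norm_waveSymbol_sq_le u _) (by positivity)
          _ = 2 * u ^ 2 * (‖ξ‖ ^ (-α) * (1 + (u * ‖ξ + η‖) ^ 2)⁻¹) := by ring
          _ ≤ 2 * u ^ 2 * (‖ξ‖ ^ (-α) * (1 + (u * ‖ξ‖) ^ 2)⁻¹ +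
                ‖ξ + η‖ ^ (-α) * (1 + (u * ‖ξ + η‖) ^ 2)⁻¹) :=
              mul_le_mul_of_nonneg_left (rpow_neg_mul_inv_le_add hα_pos (norm_pos_iff.2 h1)
                (norm_pos_iff.2 h2') u) (by positivity)
          _ = W ξ + W (ξ + η) := by simp only [hW]; ring
    _ = ENNReal.ofReal (4 * (∫ ξ, w ξ) * u ^ (α - d + 2)) := by
        rw [lintegral_add_left' hWi.1.aemeasurable.ennreal_ofReal,
          lintegral_add_right_eq_self (fun ξ => ENNReal.ofReal (W ξ)) η, hWl,
          ← ENNReal.ofReal_add (by positivity) (by positivity)]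
        ring_nf
    _ ≤ ENNReal.ofReal ((4 * (∫ ξ, w ξ) + 1) * u ^ (α - d + 2)) := by
        refine ENNReal.ofReal_le_ofReal (mul_le_mul_of_nonneg_right ?_ (by positivity))
        linarith

/-- Only the last factor contains the last frequency, shifted by the sum of the others. The bound
`hC`, uniform in the shift, removes it and the induction proceeds. -/
theorem lintegral_waveMult_le {α C : ℝ}
    (hC : ∀ (u : ℝ) (_ : 0 < u) (η : Space d),
      ∫⁻ ξ, ‖waveSymbol u (ξ + η)‖ₑ ^ 2 ∂(rieszMeasure d α) ≤
        ENNReal.ofReal (C * u ^ (α - d + 2)))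
    (n : ℕ) (s : Fin n → ℝ) (hs : ∀ j, 0 < s j) :
    ∫⁻ ξ : Fin n → Space d, ‖waveMult n s ξ‖ₑ ^ 2 ∂(Measure.pi fun _ => rieszMeasure d α) ≤
      ∏ j, ENNReal.ofReal (C * s j ^ (α - d + 2)) := by
  induction n with
  | zero => simp [waveMult]
  | succ n ih =>
    have hm : ∀ (n : ℕ) (s : Fin n → ℝ),
        Measurable fun ξ : Fin n → Space d => ‖waveMult n s ξ‖ₑ ^ 2 := fun n s => by
      have := (continuous_waveMult (d := d) s).measurable
      fun_prop
    rw [← (measurePreserving_snoc (rieszMeasure d α)).lintegral_comp (hm _ _),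
      lintegral_prod_symm' (fun p : Space d × (Fin n → Space d) =>
        ‖waveMult (n + 1) s (Fin.snoc p.2 p.1 : Fin (n + 1) → Space d)‖ₑ ^ 2)
        ((hm _ _).comp measurableEmbedding_snoc.measurable),
      Fin.prod_univ_castSucc]
    have e1 : ∀ (ξ : Space d) (ω : Fin n → Space d),
        ‖waveMult (n + 1) s (Fin.snoc ω ξ : Fin (n + 1) → Space d)‖ₑ ^ 2 =
          ‖waveMult n (Fin.init s) ω‖ₑ ^ 2 *
            ‖waveSymbol (s (Fin.last n)) (ξ + ∑ i, ω i)‖ₑ ^ 2 := fun ξ ω => by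
      have e2 : ∑ i, (Fin.snoc ω ξ : Fin (n + 1) → Space d) i = ξ + ∑ i, ω i := by
        rw [Fin.sum_univ_castSucc]; simp [add_comm]
      rw [waveMult, Fin.init_snoc, e2, enorm_mul, mul_pow]
    have hmS : ∀ η : Space d,
        Measurable fun ξ : Space d => ‖waveSymbol (s (Fin.last n)) (ξ + η)‖ₑ ^ 2 := fun η => by
      have := (continuous_waveSymbol (d := d) (s (Fin.last n))).measurable
      fun_prop
    simp_rw [e1, lintegral_const_mul _ (hmS _)]
    refine (lintegral_mono fun ω => mul_le_mul_right (hC _ (hs _) _) _).trans ?_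
    rw [lintegral_mul_const _ (hm _ _)]
    exact mul_le_mul_left (ih (Fin.init s) fun j => hs _) _

end SpatialEstimate

/-! ### Integration over times -/

section TimeEstimate

variable {n : ℕ}

theorem lintegral_Ioi_rpow_mul_exp_neg {b r : ℝ} (hb : -1 < b) (hr : 0 < r) :
    ∫⁻ v in Set.Ioi (0 : ℝ), ENNReal.ofReal (v ^ b * Real.exp (-(r * v))) =
      ENNReal.ofReal ((1 / r) ^ (b + 1) * Real.Gamma (b + 1)) := by
  have h := Real.integral_rpow_mul_exp_neg_mul_Ioi (a := b + 1) (by linarith) hr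
  rw [add_sub_cancel_right] at h
  have hG : 0 < Real.Gamma (b + 1) := Real.Gamma_pos_of_pos (by linarith)
  rw [← h, ofReal_integral_eq_lintegral_ofReal]
  -- A non-integrable function would have integral 0, but the Gamma integral is positive.
  · by_contra hi
    rw [integral_undef hi] at h
    exact absurd h (by positivity)
  · refine (ae_restrict_iff' measurableSet_Ioi).2 (Filter.Eventually.of_forall fun v hv => ?_)
    have : (0 : ℝ) < v := hv
    positivity

/-- An upper bound for the Beta integral `∫₀ᵗ (t - s)^b s^{n(b+1)} ds`. -/
theorem lintegral_Ioo_rpow_mul_rpow_le {b t : ℝ} (hb : 0 ≤ b) (ht : 0 < t) (n : ℕ) :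
    ∫⁻ s in Set.Ioo 0 t, ENNReal.ofReal ((t - s) ^ b * s ^ (n * (b + 1))) ≤
      ENNReal.ofReal (Real.exp 1 * Real.Gamma (b + 1) * t ^ ((n + 1 : ℕ) * (b + 1)) /
        ((n + 1 : ℕ) : ℝ) ^ (b + 1)) := by
  -- Since s/t ≤ e^{-(t-s)/t}, the Beta integrand is dominated by a Gamma integrand. The rate
  -- (n+1)/t in place of n/t costs a factor e, stays positive at n = 0, and yields exactly
  -- (n+1)^{-(b+1)}.
  set r : ℝ := (n + 1) / t with hr
  have hr0 : 0 < r := by positivity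
  have hG : 0 < Real.Gamma (b + 1) := Real.Gamma_pos_of_pos (by linarith)
  set g : ℝ → ℝ≥0∞ := (Set.Ioi (0 : ℝ)).indicator fun v =>
    ENNReal.ofReal (Real.exp 1 * t ^ (n * (b + 1))) *
      ENNReal.ofReal (v ^ b * Real.exp (-(r * v))) with hg
  calc ∫⁻ s in Set.Ioo 0 t, ENNReal.ofReal ((t - s) ^ b * s ^ (n * (b + 1)))
      ≤ ∫⁻ s in Set.Ioo 0 t, g (t - s) := by
        refine setLIntegral_mono' measurableSet_Ioo fun s hs => ?_
        have hs0 : 0 < s := hs.1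
        have hts : 0 < t - s := sub_pos.2 hs.2
        rw [hg, Set.indicator_of_mem (show t - s ∈ Set.Ioi (0 : ℝ) from hts),
          ← ENNReal.ofReal_mul (by positivity)]
        refine ENNReal.ofReal_le_ofReal ?_
        have h1 : (s / t) ^ (n * (b + 1)) ≤ Real.exp 1 * Real.exp (-(r * (t - s))) := by
          calc (s / t) ^ (n * (b + 1)) ≤ (s / t) ^ (n : ℝ) := by
                refine Real.rpow_le_rpow_of_exponent_ge (by positivity)
                  ((div_le_one ht).2 hs.2.le) ?_
                nlinarith [(Nat.cast_nonneg n : (0 : ℝ) ≤ n)]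
            _ ≤ Real.exp (-((t - s) / t)) ^ (n : ℝ) := by
                refine Real.rpow_le_rpow (by positivity) ?_ (Nat.cast_nonneg n)
                have := Real.add_one_le_exp (-((t - s) / t))
                have e : -((t - s) / t) + 1 = s / t := by field_simp; ring
                rwa [e] at this
            _ = Real.exp ((t - s) / t) * Real.exp (-(r * (t - s))) := by
                rw [← Real.exp_mul, ← Real.exp_add]
                congr 1
                rw [hr]
                field_simp
                ring
            _ ≤ Real.exp 1 * Real.exp (-(r * (t - s))) := by
                refine mul_le_mul_of_nonneg_right (Real.exp_le_exp.2 ?_) (Real.exp_pos _).le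
                rw [div_le_one ht]
                linarith
        rw [Real.div_rpow hs0.le ht.le, div_le_iff₀ (by positivity)] at h1
        calc (t - s) ^ b * s ^ (n * (b + 1))
            ≤ (t - s) ^ b * (Real.exp 1 * Real.exp (-(r * (t - s))) * t ^ (n * (b + 1))) :=
              mul_le_mul_of_nonneg_left h1 (by positivity)
          _ = Real.exp 1 * t ^ (n * (b + 1)) * ((t - s) ^ b * Real.exp (-(r * (t - s)))) := by
              ring
    _ ≤ ∫⁻ s, g (t - s) := setLIntegral_le_lintegral _ _
    _ = ∫⁻ v, g v := lintegral_sub_left_eq_self g t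
    _ = ENNReal.ofReal (Real.exp 1 * t ^ (n * (b + 1)) *
          ((1 / r) ^ (b + 1) * Real.Gamma (b + 1))) := by
        rw [hg, lintegral_indicator measurableSet_Ioi, lintegral_const_mul _ (by fun_prop),
          lintegral_Ioi_rpow_mul_exp_neg (by linarith) hr0, ← ENNReal.ofReal_mul (by positivity)]
    _ = _ := by
        congr 1
        rw [hr, one_div_div, Real.div_rpow ht.le (by positivity)]
        rw [show ((n + 1 : ℕ) : ℝ) * (b + 1) = n * (b + 1) + (b + 1) by push_cast; ring,
          Real.rpow_add ht (n * (b + 1))]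
        push_cast
        ring

theorem snoc_mem_orderedTimes {t s : ℝ} {τ : Fin n → ℝ} :
    (Fin.snoc τ s : Fin (n + 1) → ℝ) ∈ orderedTimes (n + 1) t ↔
      s ∈ Set.Ioo 0 t ∧ τ ∈ orderedTimes n s := by
  constructor
  · rintro ⟨h1, h2⟩
    have hs : s ∈ Set.Ioo 0 t := by simpa using h2 (Fin.last n)
    refine ⟨hs, fun i j hij => ?_, fun j => ⟨?_, ?_⟩⟩
    · simpa using h1 (Fin.castSucc_lt_castSucc_iff.2 hij)
    · simpa using (h2 j.castSucc).1
    · simpa using h1 (Fin.castSucc_lt_last j)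
  · rintro ⟨hs, h1, h2⟩
    refine ⟨fun i j hij => ?_, fun j => ?_⟩
    · induction j using Fin.lastCases with
      | last =>
        induction i using Fin.lastCases with
        | last => exact absurd hij (lt_irrefl _)
        | cast i => simpa using (h2 i).2
      | cast j =>
        induction i using Fin.lastCases with
        | last => exact absurd (hij.trans (Fin.castSucc_lt_last j)) (lt_irrefl _)
        | cast i => simpa using h1 (Fin.castSucc_lt_castSucc_iff.1 hij)
    · induction j using Fin.lastCases with
      | last => simpa using hs
      | cast j => simpa using ⟨(h2 j).1, (h2 j).2.trans hs.2⟩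

theorem increments_snoc_last (t s : ℝ) (τ : Fin n → ℝ) :
    increments t (Fin.snoc τ s : Fin (n + 1) → ℝ) (Fin.last n) = t - s := by
  rw [increments, Fin.succ_last, Fin.snoc_last, Fin.snoc_last]

theorem increments_snoc_castSucc (t s : ℝ) (τ : Fin n → ℝ) (j : Fin n) :
    increments t (Fin.snoc τ s : Fin (n + 1) → ℝ) j.castSucc = increments s τ j := by
  rw [increments, Fin.succ_castSucc, Fin.snoc_castSucc, Fin.snoc_castSucc, increments]

theorem increments_pos {t : ℝ} {τ : Fin n → ℝ} (hτ : τ ∈ orderedTimes n t) (j : Fin n) :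
    0 < increments t τ j := by
  induction n generalizing t with
  | zero => exact j.elim0
  | succ n ih =>
    rw [← Fin.snoc_init_self τ] at hτ ⊢
    obtain ⟨h1, h2⟩ := snoc_mem_orderedTimes.1 hτ
    induction j using Fin.lastCases with
    | last => rw [increments_snoc_last]; exact sub_pos.2 h1.2
    | cast j => rw [increments_snoc_castSucc]; exact ih h2 j

theorem measurable_increments (t : ℝ) (j : Fin n) :
    Measurable fun τ : Fin n → ℝ => increments t τ j := by
  refine Measurable.sub ?_ (measurable_pi_apply j)
  generalize j.succ = k
  induction k using Fin.lastCases with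
  | last => simp
  | cast i => simpa using measurable_pi_apply i

theorem measurableSet_orderedTimes (n : ℕ) (t : ℝ) : MeasurableSet (orderedTimes n t) := by
  have : orderedTimes n t = (⋂ i, ⋂ j, ⋂ (_ : i < j), {τ : Fin n → ℝ | τ i < τ j}) ∩
      ⋂ j, {τ | τ j ∈ Set.Ioo 0 t} := by
    ext τ
    simp only [orderedTimes, Set.mem_inter_iff, Set.mem_iInter, Set.mem_ofPred_eq]
    exact Iff.rfl
  rw [this]
  refine MeasurableSet.inter ?_ ?_
  · refine MeasurableSet.iInter fun i => MeasurableSet.iInter fun j =>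
      MeasurableSet.iInter fun _ => ?_
    exact measurableSet_lt (measurable_pi_apply i) (measurable_pi_apply j)
  · exact MeasurableSet.iInter fun j => measurable_pi_apply j measurableSet_Ioo

/-- An upper bound for the Dirichlet integral over the ordered times. -/
theorem lintegral_orderedTimes_le {b : ℝ} (hb : 0 ≤ b) (n : ℕ) {t : ℝ} (ht : 0 < t) :
    ∫⁻ τ in orderedTimes n t, ∏ j, ENNReal.ofReal (increments t τ j ^ b) ≤
      ENNReal.ofReal ((Real.exp 1 * Real.Gamma (b + 1)) ^ n * t ^ (n * (b + 1)) /
        (n.factorial : ℝ) ^ (b + 1)) := by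
  have hG : 0 < Real.Gamma (b + 1) := Real.Gamma_pos_of_pos (by linarith)
  induction n generalizing t with
  | zero =>
    refine (setLIntegral_le_lintegral _ _).trans ?_
    simp [volume_pi]
  | succ n ih =>
    have hmeas : ∀ (n : ℕ) (t : ℝ),
        Measurable fun τ : Fin n → ℝ => ∏ j, ENNReal.ofReal (increments t τ j ^ b) := fun n t => by
      have := fun j => measurable_increments (n := n) t j
      fun_prop
    have hmp : MeasurePreserving
        (fun p : ℝ × (Fin n → ℝ) => (Fin.snoc p.2 p.1 : Fin (n + 1) → ℝ))
        (volume.prod volume) volume := measurePreserving_snoc volume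
    have hind := (hmeas (n + 1) t).indicator (measurableSet_orderedTimes (n + 1) t)
    -- With the last time s fixed, the earlier times are ordered in (0, s) and their increments end
    -- at s, so the induction hypothesis applies with s for t.
    have e1 : ∀ (s : ℝ) (τ : Fin n → ℝ),
        (orderedTimes (n + 1) t).indicator
          (fun τ => ∏ j, ENNReal.ofReal (increments t τ j ^ b)) (Fin.snoc τ s) =
        (Set.Ioo 0 t).indicator (fun s => ENNReal.ofReal ((t - s) ^ b) *
          (orderedTimes n s).indicator
            (fun τ => ∏ j, ENNReal.ofReal (increments s τ j ^ b)) τ) s := by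
      intro s τ
      by_cases hs : s ∈ Set.Ioo 0 t
      · by_cases hτ : τ ∈ orderedTimes n s
        · rw [Set.indicator_of_mem (snoc_mem_orderedTimes.2 ⟨hs, hτ⟩), Set.indicator_of_mem hs,
            Set.indicator_of_mem hτ, Fin.prod_univ_castSucc, increments_snoc_last, mul_comm]
          simp_rw [increments_snoc_castSucc]
        · rw [Set.indicator_of_notMem fun h => hτ (snoc_mem_orderedTimes.1 h).2,
            Set.indicator_of_mem hs, Set.indicator_of_notMem hτ, mul_zero]
      · rw [Set.indicator_of_notMem fun h => hs (snoc_mem_orderedTimes.1 h).1,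
          Set.indicator_of_notMem hs]
    rw [← lintegral_indicator (measurableSet_orderedTimes _ _), ← hmp.lintegral_comp hind,
      lintegral_prod (fun p : ℝ × (Fin n → ℝ) => (orderedTimes (n + 1) t).indicator
        (fun τ => ∏ j, ENNReal.ofReal (increments t τ j ^ b)) (Fin.snoc p.2 p.1))
        (hind.comp measurableEmbedding_snoc.measurable).aemeasurable]
    calc ∫⁻ s : ℝ, ∫⁻ τ : Fin n → ℝ, (orderedTimes (n + 1) t).indicator
          (fun τ => ∏ j, ENNReal.ofReal (increments t τ j ^ b)) (Fin.snoc τ s)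
        = ∫⁻ s in Set.Ioo 0 t, ENNReal.ofReal ((t - s) ^ b) *
            ∫⁻ τ in orderedTimes n s, ∏ j, ENNReal.ofReal (increments s τ j ^ b) := by
          rw [← lintegral_indicator measurableSet_Ioo]
          congr 1 with s
          simp_rw [e1]
          by_cases hs : s ∈ Set.Ioo 0 t
          · simp_rw [Set.indicator_of_mem hs]
            rw [lintegral_const_mul _ ((hmeas n s).indicator (measurableSet_orderedTimes n s)),
              lintegral_indicator (measurableSet_orderedTimes _ _)]
          · simp_rw [Set.indicator_of_notMem hs, lintegral_zero]
      _ ≤ ∫⁻ s in Set.Ioo 0 t, ENNReal.ofReal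
            ((Real.exp 1 * Real.Gamma (b + 1)) ^ n / (n.factorial : ℝ) ^ (b + 1)) *
            ENNReal.ofReal ((t - s) ^ b * s ^ (n * (b + 1))) := by
          refine setLIntegral_mono' measurableSet_Ioo fun s hs => ?_
          refine (mul_le_mul_right (ih hs.1) _).trans_eq ?_
          have : 0 < t - s := sub_pos.2 hs.2
          rw [← ENNReal.ofReal_mul (by positivity), ← ENNReal.ofReal_mul (by positivity)]
          congr 1
          ring
      _ ≤ _ := by
          rw [lintegral_const_mul _ (by fun_prop)]
          -- The new factor (n+1)^{-(b+1)} completes (n!)^{-(b+1)} to the next factorial.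
          refine (mul_le_mul_right (lintegral_Ioo_rpow_mul_rpow_le hb ht n) _).trans_eq ?_
          rw [← ENNReal.ofReal_mul (by positivity), Nat.factorial_succ, Nat.cast_mul,
            Real.mul_rpow (by positivity) (by positivity)]
          congr 1
          ring

theorem lintegral_Ioo_rpow {c t : ℝ} (hc : -1 < c) (ht : 0 < t) :
    ∫⁻ v in Set.Ioo 0 t, ENNReal.ofReal (v ^ c) = ENNReal.ofReal (t ^ (c + 1) / (c + 1)) := by
  have hi : IntegrableOn (fun v : ℝ => v ^ c) (Set.Ioo 0 t) := by
    rw [← integrableOn_Ioc_iff_integrableOn_Ioo,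
      ← intervalIntegrable_iff_integrableOn_Ioc_of_le ht.le]
    exact intervalIntegral.intervalIntegrable_rpow' hc
  rw [← ofReal_integral_eq_lintegral_ofReal hi, ← integral_Ioc_eq_integral_Ioo,
    ← intervalIntegral.integral_of_le ht.le, integral_rpow (Or.inl hc),
    Real.zero_rpow (by linarith), sub_zero]
  refine (ae_restrict_iff' measurableSet_Ioo).2 (Filter.Eventually.of_forall fun v hv => ?_)
  exact Real.rpow_nonneg hv.1.le _

theorem lintegral_Ioo_abs_sub_rpow_le {c t : ℝ} (hc : -1 < c) (hc0 : c ≠ 0) (ht : 0 < t) {r : ℝ}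
    (hr : r ∈ Set.Ioo 0 t) :
    ∫⁻ s in Set.Ioo 0 t, ENNReal.ofReal (|r - s| ^ c) ≤
      ENNReal.ofReal (2 * t ^ (c + 1) / (c + 1)) := by
  set g : ℝ → ℝ≥0∞ := (Set.Ioo 0 t).indicator fun v => ENNReal.ofReal (v ^ c) with hg
  have hgm : Measurable g := Measurable.indicator (by fun_prop) measurableSet_Ioo
  have hgi : ∫⁻ v, g v = ENNReal.ofReal (t ^ (c + 1) / (c + 1)) := by
    rw [hg, lintegral_indicator measurableSet_Ioo, lintegral_Ioo_rpow hc ht]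
  have hc1 : 0 < c + 1 := by linarith
  calc ∫⁻ s in Set.Ioo 0 t, ENNReal.ofReal (|r - s| ^ c)
      ≤ ∫⁻ s in Set.Ioo 0 t, (g (r - s) + g (s - r)) := by
        refine setLIntegral_mono' measurableSet_Ioo fun s hs => ?_
        rcases lt_trichotomy s r with h | rfl | h
        · rw [abs_of_pos (sub_pos.2 h)]
          refine le_add_of_le_of_nonneg ?_ zero_le
          rw [hg, Set.indicator_of_mem]
          exact ⟨sub_pos.2 h, by linarith [hs.1, hr.2]⟩
        -- On the diagonal 0 ^ c = 0 because c ≠ 0.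
        · simp [Real.zero_rpow hc0]
        · rw [abs_sub_comm, abs_of_pos (sub_pos.2 h)]
          refine le_add_of_nonneg_of_le zero_le ?_
          rw [hg, Set.indicator_of_mem]
          exact ⟨sub_pos.2 h, by linarith [hs.2, hr.1]⟩
    _ ≤ ∫⁻ s, (g (r - s) + g (s - r)) := setLIntegral_le_lintegral _ _
    _ = ENNReal.ofReal (2 * t ^ (c + 1) / (c + 1)) := by
        rw [lintegral_add_left (f := fun s => g (r - s)) (by fun_prop), lintegral_sub_left_eq_self g r,
          lintegral_sub_right_eq_self g r, hgi, ← ENNReal.ofReal_add (by positivity)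
          (by positivity)]
        congr 1
        ring

theorem lintegral_pi_prod {X : Type*} [MeasurableSpace X] (μ : Measure X) [SigmaFinite μ]
    (f : Fin n → X → ℝ≥0∞) (hf : ∀ j, Measurable (f j)) :
    ∫⁻ x, ∏ j, f j (x j) ∂(Measure.pi fun _ => μ) = ∏ j, ∫⁻ y, f j y ∂μ := by
  induction n with
  | zero => simp
  | succ n ih =>
    rw [← (measurePreserving_snoc μ).lintegral_comp (by fun_prop), Fin.prod_univ_castSucc,
      ← ih _ fun j => hf _, mul_comm, ← lintegral_prod_mul (hf _).aemeasurable
      (Finset.measurable_fun_prod _ fun j _ => (hf j.castSucc).comp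
        (measurable_pi_apply j)).aemeasurable]
    simp_rw [Fin.prod_univ_castSucc, Fin.snoc_castSucc, Fin.snoc_last, mul_comm]

theorem lintegral_timeCube_prod_le {c t : ℝ} (hc : -1 < c) (hc0 : c ≠ 0) (ht : 0 < t)
    {τ : Fin n → ℝ} (hτ : τ ∈ timeCube n t) :
    ∫⁻ σ in timeCube n t, ENNReal.ofReal (∏ j, |τ j - σ j| ^ c) ≤
      ENNReal.ofReal (2 * t ^ (c + 1) / (c + 1)) ^ n := by
  simp_rw [ENNReal.ofReal_prod_of_nonneg fun _ _ => Real.rpow_nonneg (abs_nonneg _) c]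
  rw [timeCube, volume_pi, Measure.restrict_pi_pi,
    lintegral_pi_prod _ (fun j s => ENNReal.ofReal (|τ j - s| ^ c)) fun j => by fun_prop]
  refine (Finset.prod_le_prod' fun j _ =>
    lintegral_Ioo_abs_sub_rpow_le hc hc0 ht (hτ j (Set.mem_univ j))).trans_eq ?_
  simp

end TimeEstimate

/-! ### Symmetrized norms and the Schur test -/

section Assembly

variable {d n : ℕ}

theorem measurable_uncurry_kernelFun (t : ℝ) (x : Space d) :
    Measurable fun p : (Fin n → ℝ) × (Fin n → Space d) => kernelFun t x p.1 p.2 := by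
  have h1 : Measurable fun p : (Fin n → ℝ) × (Fin n → Space d) =>
      Complex.exp (-Complex.I * (inner ℝ (∑ i, p.2 i) x : ℝ)) *
        waveMult n (increments t p.1) p.2 := by
    have hinc : Measurable fun τ : Fin n → ℝ => increments t τ :=
      measurable_pi_lambda _ fun j => measurable_increments t j
    have hmult : Measurable fun p : (Fin n → ℝ) × (Fin n → Space d) =>
        waveMult n (increments t p.1) p.2 :=
      (continuous_uncurry_waveMult n).measurable.comp
        ((hinc.comp measurable_fst).prodMk measurable_snd)
    have hexp : Continuous fun p : (Fin n → ℝ) × (Fin n → Space d) =>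
        Complex.exp (-Complex.I * (inner ℝ (∑ i, p.2 i) x : ℝ)) := by fun_prop
    exact hexp.measurable.mul hmult
  exact h1.indicator (measurable_fst (measurableSet_orderedTimes n t))

theorem measurable_uncurry_symmetrizeFun {K : (Fin n → ℝ) → (Fin n → Space d) → ℂ}
    (hK : Measurable fun p : (Fin n → ℝ) × (Fin n → Space d) => K p.1 p.2) :
    Measurable fun p : (Fin n → ℝ) × (Fin n → Space d) => symmetrizeFun K p.1 p.2 := by
  refine Measurable.const_mul ?_ _
  refine Finset.measurable_fun_sum _ fun ρ _ => ?_
  exact hK.comp (((measurableEmbedding_comp_perm ρ).measurable.comp measurable_fst).prodMk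
    ((measurableEmbedding_comp_perm ρ).measurable.comp measurable_snd))

theorem perm_eq_of_strictMono {τ : Fin n → ℝ} {ρ ρ' : Equiv.Perm (Fin n)}
    (h : StrictMono (τ ∘ ρ)) (h' : StrictMono (τ ∘ ρ')) : ρ = ρ' := by
  have h1 : τ ∘ ρ = τ ∘ ρ' := by
    rw [← h.range_inj h', ρ.surjective.range_comp, ρ'.surjective.range_comp]
  have hinj : Function.Injective τ := by
    have := h.injective.comp ρ.symm.injective
    rwa [Function.comp_assoc, Equiv.self_comp_symm, Function.comp_id] at this
  exact Equiv.ext fun j => hinj (congrFun h1 j)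

/-- At most one permutation puts τ in increasing order, so at most one summand is nonzero and the
square of the sum has no cross terms. -/
theorem enorm_symmetrizeFun_kernelFun_sq_le (t : ℝ) (x : Space d) (τ : Fin n → ℝ)
    (ξ : Fin n → Space d) :
    ‖symmetrizeFun (kernelFun t x) τ ξ‖ₑ ^ 2 ≤ ‖(n.factorial : ℂ)⁻¹‖ₑ ^ 2 *
      ∑ ρ : Equiv.Perm (Fin n), ‖kernelFun t x (τ ∘ ρ) (ξ ∘ ρ)‖ₑ ^ 2 := by
  rw [symmetrizeFun, enorm_mul, mul_pow]
  refine mul_le_mul_right ?_ _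
  by_cases h : ∃ ρ : Equiv.Perm (Fin n), τ ∘ ρ ∈ orderedTimes n t
  · obtain ⟨ρ₀, hρ₀⟩ := h
    rw [Finset.sum_eq_single_of_mem ρ₀ (Finset.mem_univ _) fun ρ _ hρ => ?_]
    · exact Finset.single_le_sum
        (f := fun ρ : Equiv.Perm (Fin n) => ‖kernelFun t x (τ ∘ ρ) (ξ ∘ ρ)‖ₑ ^ 2)
        (fun _ _ => zero_le) (Finset.mem_univ ρ₀)
    · rw [kernelFun, Set.indicator_of_notMem]
      exact fun hm => hρ (perm_eq_of_strictMono hm.1 hρ₀.1)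
  · rw [Finset.sum_eq_zero fun ρ _ => ?_]
    · simp
    · rw [kernelFun, Set.indicator_of_notMem]
      exact fun hm => h ⟨ρ, hm⟩

/-- The squared norm `∫ |K(ξ)|² μ(dξ₁) ⋯ μ(dξₙ)` in `[0, ∞]`. -/
def spatialSq (α : ℝ) (K : (Fin n → Space d) → ℂ) : ℝ≥0∞ :=
  ∫⁻ ξ, ‖K ξ‖ₑ ^ 2 ∂(Measure.pi fun _ => rieszMeasure d α)

theorem measurable_spatialSq (α : ℝ) {K : (Fin n → ℝ) → (Fin n → Space d) → ℂ}
    (hK : Measurable fun p : (Fin n → ℝ) × (Fin n → Space d) => K p.1 p.2) :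
    Measurable fun τ => spatialSq α (K τ) :=
  (hK.enorm.pow_const 2).lintegral_prod_right'

theorem spatialSq_kernelFun_le {α C : ℝ}
    (hC : ∀ (u : ℝ) (_ : 0 < u) (η : Space d),
      ∫⁻ ξ, ‖waveSymbol u (ξ + η)‖ₑ ^ 2 ∂(rieszMeasure d α) ≤
        ENNReal.ofReal (C * u ^ (α - d + 2)))
    (t : ℝ) (x : Space d) (τ : Fin n → ℝ) :
    spatialSq α (kernelFun t x τ) ≤ (orderedTimes n t).indicator
      (fun τ => ∏ j, ENNReal.ofReal (C * increments t τ j ^ (α - d + 2))) τ := by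
  by_cases hτ : τ ∈ orderedTimes n t
  · rw [Set.indicator_of_mem hτ]
    refine le_trans (le_of_eq ?_) (lintegral_waveMult_le hC n _ (increments_pos hτ))
    rw [spatialSq]
    congr 1 with ξ
    rw [kernelFun, Set.indicator_of_mem hτ, enorm_mul, ← ofReal_norm (Complex.exp _),
      norm_exp_neg_I_mul, ENNReal.ofReal_one, one_mul]
  · rw [Set.indicator_of_notMem hτ, spatialSq]
    simp [kernelFun, Set.indicator_of_notMem hτ]

theorem spatialSq_symmetrizeFun_le (α t : ℝ) (x : Space d) (τ : Fin n → ℝ) :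
    spatialSq α (symmetrizeFun (kernelFun t x) τ) ≤ ‖(n.factorial : ℂ)⁻¹‖ₑ ^ 2 *
      ∑ ρ : Equiv.Perm (Fin n), spatialSq α (kernelFun t x (τ ∘ ρ)) := by
  have hm : ∀ τ : Fin n → ℝ, Measurable fun ξ : Fin n → Space d =>
      ‖kernelFun t x τ ξ‖ₑ ^ 2 := fun τ =>
    ((measurable_uncurry_kernelFun t x).comp measurable_prodMk_left).enorm.pow_const 2
  have hmρ : ∀ ρ : Equiv.Perm (Fin n), Measurable fun ξ : Fin n → Space d =>
      ‖kernelFun t x (τ ∘ ρ) (ξ ∘ ρ)‖ₑ ^ 2 := fun ρ =>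
    (hm (τ ∘ ρ)).comp (measurableEmbedding_comp_perm ρ).measurable
  refine (lintegral_mono fun ξ => enorm_symmetrizeFun_kernelFun_sq_le t x τ ξ).trans_eq ?_
  rw [lintegral_const_mul _ (Finset.measurable_fun_sum _ fun ρ _ => hmρ ρ),
    lintegral_finsetSum _ fun ρ _ => hmρ ρ]
  congr 1
  refine Finset.sum_congr rfl fun ρ _ => ?_
  exact (measurePreserving_comp_perm (rieszMeasure d α) ρ).lintegral_comp (hm (τ ∘ ρ))

/-- All n! permutations contribute the same integral, so the prefactor (1/n!)² becomes 1/n!. -/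
theorem lintegral_spatialSq_symmetrizeFun_le {α C : ℝ} (hC0 : 0 ≤ C) (hα : (d : ℝ) - 2 < α)
    (hC : ∀ (u : ℝ) (_ : 0 < u) (η : Space d),
      ∫⁻ ξ, ‖waveSymbol u (ξ + η)‖ₑ ^ 2 ∂(rieszMeasure d α) ≤
        ENNReal.ofReal (C * u ^ (α - d + 2)))
    {t : ℝ} (ht : 0 < t) (x : Space d) :
    ∫⁻ τ : Fin n → ℝ, spatialSq α (symmetrizeFun (kernelFun t x) τ) ≤
      ENNReal.ofReal ((n.factorial : ℝ)⁻¹ * (C ^ n *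
        ((Real.exp 1 * Real.Gamma (α - d + 2 + 1)) ^ n * t ^ (n * (α - d + 2 + 1)) /
        (n.factorial : ℝ) ^ (α - d + 2 + 1)))) := by
  have hmp : ∀ ρ : Equiv.Perm (Fin n), MeasurePreserving (fun τ : Fin n → ℝ => τ ∘ ρ)
      volume volume := fun ρ => measurePreserving_comp_perm volume ρ
  have hm := measurable_spatialSq α (measurable_uncurry_kernelFun (n := n) t x)
  have h1 : ∫⁻ τ : Fin n → ℝ, spatialSq α (kernelFun t x τ) ≤ ENNReal.ofReal (C ^ n *
        ((Real.exp 1 * Real.Gamma (α - d + 2 + 1)) ^ n * t ^ (n * (α - d + 2 + 1)) /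
        (n.factorial : ℝ) ^ (α - d + 2 + 1))) := by
    refine (lintegral_mono fun τ => spatialSq_kernelFun_le hC t x τ).trans ?_
    rw [lintegral_indicator (measurableSet_orderedTimes n t)]
    simp_rw [ENNReal.ofReal_mul hC0, Finset.prod_mul_distrib]
    rw [lintegral_const_mul _ (by
      have := fun j => measurable_increments (n := n) t j
      fun_prop), ENNReal.ofReal_mul (pow_nonneg hC0 n)]
    refine mul_le_mul' ?_ (lintegral_orderedTimes_le (by linarith) n ht)
    rw [ENNReal.ofReal_pow hC0]
    simp
  refine (lintegral_mono fun τ => spatialSq_symmetrizeFun_le α t x τ).trans ?_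
  have hmρ : ∀ ρ : Equiv.Perm (Fin n), Measurable fun τ : Fin n → ℝ =>
      spatialSq α (kernelFun t x (τ ∘ ρ)) := fun ρ =>
    hm.comp (measurableEmbedding_comp_perm ρ).measurable
  rw [lintegral_const_mul _ (Finset.measurable_fun_sum _ fun ρ _ => hmρ ρ),
    lintegral_finsetSum _ fun ρ _ => hmρ ρ]
  have h2 : ∀ ρ : Equiv.Perm (Fin n),
      ∫⁻ τ : Fin n → ℝ, spatialSq α (kernelFun t x (τ ∘ ρ)) =
        ∫⁻ τ : Fin n → ℝ, spatialSq α (kernelFun t x τ) := fun ρ => (hmp ρ).lintegral_comp hm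
  simp_rw [h2]
  rw [Finset.sum_const, Finset.card_univ, Fintype.card_perm, Fintype.card_fin, nsmul_eq_mul,
    ← mul_assoc, ENNReal.ofReal_mul (by positivity)]
  refine mul_le_mul' (le_of_eq ?_) h1
  have hf : (0 : ℝ) < n.factorial := by exact_mod_cast n.factorial_pos
  rw [← ofReal_norm, norm_inv, Complex.norm_natCast, ← ENNReal.ofReal_pow (by positivity),
    ← ENNReal.ofReal_natCast, ← ENNReal.ofReal_mul (by positivity)]
  congr 1
  field_simp

theorem enorm_mul_conj_le (a b : ℂ) : ‖a * conj b‖ₑ ≤ ‖a‖ₑ ^ 2 + ‖b‖ₑ ^ 2 := by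
  have hb : ‖conj b‖ₑ = ‖b‖ₑ := by rw [← ofReal_norm, RCLike.norm_conj, ofReal_norm]
  rw [enorm_mul, hb]
  rcases le_total ‖a‖ₑ ‖b‖ₑ with h | h
  · exact (mul_le_mul_left h _).trans ((sq ‖b‖ₑ).symm.le.trans le_add_self)
  · exact (mul_le_mul_right h _).trans ((sq ‖a‖ₑ).symm.le.trans le_self_add)

theorem lintegral_enorm_mul_conj_le (α : ℝ) {K L : (Fin n → Space d) → ℂ} (hK : Measurable K) :
    ∫⁻ ξ, ‖K ξ * conj (L ξ)‖ₑ ∂(Measure.pi fun _ => rieszMeasure d α) ≤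
      spatialSq α K + spatialSq α L := by
  refine (lintegral_mono fun ξ => enorm_mul_conj_le (K ξ) (L ξ)).trans_eq ?_
  exact lintegral_add_left (hK.enorm.pow_const 2) _

theorem fourierFunction_symmetrize_kernel_ae_eq (α t : ℝ) (x : Space d) (τ : Fin n → ℝ) :
    fourierFunction (symmetrize (kernel t x) τ)
      =ᵐ[Measure.pi fun _ => rieszMeasure d α] symmetrizeFun (kernelFun t x) τ :=
  (rieszMeasure_pi_absolutelyContinuous α n).ae_eq
    (IsFourierFunction.symmetrize (isFourierFunction_kernel t x) τ).fourierFunction_ae_eq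

theorem fourierFunction_mul_conj_ae_eq (α t : ℝ) (x : Space d) (τ σ : Fin n → ℝ) :
    (fun ξ => fourierFunction (symmetrize (kernel t x) τ) ξ *
        conj (fourierFunction (symmetrize (kernel t x) σ) ξ))
      =ᵐ[Measure.pi fun _ => rieszMeasure d α]
    fun ξ => symmetrizeFun (kernelFun t x) τ ξ * conj (symmetrizeFun (kernelFun t x) σ ξ) := by
  filter_upwards [fourierFunction_symmetrize_kernel_ae_eq α t x τ,
    fourierFunction_symmetrize_kernel_ae_eq α t x σ] with ξ h1 h2
  rw [h1, h2]

/-- The identity holds at every pair of times, so measurability in time can be read off the explicit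
formula although `fourierFunction` is chosen separately at each time. -/
theorem spatialInner_symmetrize_kernel (α t : ℝ) (x : Space d) (τ σ : Fin n → ℝ) :
    spatialInner α (symmetrize (kernel t x)) τ σ =
      ∫ ξ, symmetrizeFun (kernelFun t x) τ ξ * conj (symmetrizeFun (kernelFun t x) σ ξ)
        ∂(Measure.pi fun _ => rieszMeasure d α) :=
  integral_congr_ae (fourierFunction_mul_conj_ae_eq α t x τ σ)

theorem measurable_symmetrizeFun_kernelFun (t : ℝ) (x : Space d) (τ : Fin n → ℝ) :
    Measurable (symmetrizeFun (kernelFun t x) τ) := by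
  have hS := measurable_uncurry_symmetrizeFun (measurable_uncurry_kernelFun (n := n) t x)
  generalize symmetrizeFun (kernelFun t x) = S at hS ⊢
  exact hS.comp measurable_prodMk_left

theorem stronglyMeasurable_integral_mul_conj {V : Type*} [MeasurableSpace V] (ν : Measure V)
    [SFinite ν] {T : Type*} [MeasurableSpace T] {S : T → V → ℂ}
    (hS : Measurable fun p : T × V => S p.1 p.2) :
    StronglyMeasurable fun p : T × T => ∫ ξ, S p.1 ξ * conj (S p.2 ξ) ∂ν := by
  refine StronglyMeasurable.integral_prod_right
    (f := fun (p : T × T) (ξ : V) => S p.1 ξ * conj (S p.2 ξ)) ?_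
  refine Measurable.stronglyMeasurable ?_
  have h1 : Measurable fun q : (T × T) × V => S q.1.1 q.2 :=
    hS.comp ((measurable_fst.comp measurable_fst).prodMk measurable_snd)
  have h2 : Measurable fun q : (T × T) × V => S q.1.2 q.2 :=
    hS.comp ((measurable_snd.comp measurable_fst).prodMk measurable_snd)
  exact h1.mul (Complex.continuous_conj.measurable.comp h2)

theorem stronglyMeasurable_timeIntegrand (α H t : ℝ) (x : Space d) :
    StronglyMeasurable (timeIntegrand (n := n) α H (symmetrize (kernel t x))) := by
  have hw : Measurable fun p : (Fin n → ℝ) × (Fin n → ℝ) =>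
      ((∏ j, |p.1 j - p.2 j| ^ (2 * H - 2) : ℝ) : ℂ) := by fun_prop
  have hI : StronglyMeasurable fun p : (Fin n → ℝ) × (Fin n → ℝ) =>
      spatialInner α (symmetrize (kernel t x)) p.1 p.2 := by
    simp_rw [spatialInner_symmetrize_kernel]
    exact stronglyMeasurable_integral_mul_conj _
      (measurable_uncurry_symmetrizeFun (measurable_uncurry_kernelFun t x))
  exact hw.stronglyMeasurable.mul hI

theorem enorm_timeIntegrand_le (α H t : ℝ) (x : Space d) (p : (Fin n → ℝ) × (Fin n → ℝ)) :
    ‖timeIntegrand α H (symmetrize (kernel t x)) p‖ₑ ≤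
      ENNReal.ofReal (∏ j, |p.1 j - p.2 j| ^ (2 * H - 2)) *
        (spatialSq α (symmetrizeFun (kernelFun t x) p.1) +
          spatialSq α (symmetrizeFun (kernelFun t x) p.2)) := by
  rw [timeIntegrand, enorm_mul]
  refine mul_le_mul' (le_of_eq ?_) ?_
  · rw [← ofReal_norm, Complex.norm_real, Real.norm_of_nonneg]
    exact Finset.prod_nonneg fun j _ => Real.rpow_nonneg (abs_nonneg _) _
  · rw [spatialInner_symmetrize_kernel]
    exact (enorm_integral_le_lintegral_enorm _).trans
      (lintegral_enorm_mul_conj_le α (measurable_symmetrizeFun_kernelFun t x p.1))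

/-- Schur test: after |a conj b| ≤ |a|² + |b|², each summand depends on one time vector only, and
the singular weight is integrated over the other, uniformly in the first. -/
theorem lintegral_timeIntegrand_le {α H t : ℝ} (hH : 1 / 2 < H) (hH_lt : H < 1) (ht : 0 < t)
    (x : Space d) :
    ∫⁻ p in timeCube n t ×ˢ timeCube n t, ‖timeIntegrand α H (symmetrize (kernel t x)) p‖ₑ ≤
      2 * (ENNReal.ofReal (2 * t ^ (2 * H - 2 + 1) / (2 * H - 2 + 1)) ^ n *
        ∫⁻ τ : Fin n → ℝ, spatialSq α (symmetrizeFun (kernelFun t x) τ)) := by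
  set E : (Fin n → ℝ) → ℝ≥0∞ := fun τ => spatialSq α (symmetrizeFun (kernelFun t x) τ) with hE
  set B := ENNReal.ofReal (2 * t ^ (2 * H - 2 + 1) / (2 * H - 2 + 1)) ^ n with hB
  set w : (Fin n → ℝ) × (Fin n → ℝ) → ℝ≥0∞ := fun p =>
    ENNReal.ofReal (∏ j, |p.1 j - p.2 j| ^ (2 * H - 2)) with hw
  have hEm : Measurable E := measurable_spatialSq α
    (measurable_uncurry_symmetrizeFun (measurable_uncurry_kernelFun t x))
  have hwm : Measurable w := by fun_prop
  have hcube : MeasurableSet (timeCube n t) := MeasurableSet.univ_pi fun _ => measurableSet_Ioo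
  have hone : ∫⁻ τ in timeCube n t, ∫⁻ σ in timeCube n t, w (τ, σ) * E τ ≤ B * ∫⁻ τ, E τ := by
    calc ∫⁻ τ in timeCube n t, ∫⁻ σ in timeCube n t, w (τ, σ) * E τ
        ≤ ∫⁻ τ in timeCube n t, B * E τ := by
          refine setLIntegral_mono' hcube fun τ hτ => ?_
          have hwτ : Measurable fun σ => w (τ, σ) := hwm.comp measurable_prodMk_left
          rw [lintegral_mul_const _ hwτ]
          exact mul_le_mul_left (lintegral_timeCube_prod_le (by linarith) (by linarith) ht hτ) _
      _ ≤ ∫⁻ τ, B * E τ := setLIntegral_le_lintegral _ _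
      _ = B * ∫⁻ τ, E τ := lintegral_const_mul _ hEm
  have hw1 : Measurable fun p : (Fin n → ℝ) × (Fin n → ℝ) => w p * E p.1 :=
    hwm.mul (hEm.comp measurable_fst)
  have hw2 : Measurable fun p : (Fin n → ℝ) × (Fin n → ℝ) => w p * E p.2 :=
    hwm.mul (hEm.comp measurable_snd)
  have hle : ∀ p : (Fin n → ℝ) × (Fin n → ℝ),
      ‖timeIntegrand α H (symmetrize (kernel t x)) p‖ₑ ≤ w p * E p.1 + w p * E p.2 := fun p =>
    (enorm_timeIntegrand_le α H t x p).trans_eq (mul_add _ _ _)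
  refine (lintegral_mono hle).trans ?_
  rw [Measure.volume_eq_prod, ← Measure.prod_restrict, lintegral_add_left hw1,
    two_mul (B * ∫⁻ τ, E τ)]
  refine add_le_add ?_ ?_
  · rw [lintegral_prod (fun p : (Fin n → ℝ) × (Fin n → ℝ) => w p * E p.1) hw1.aemeasurable]
    exact hone
  -- Integrating in the other order and using the symmetry of the weight reduces to `hone`.
  · rw [lintegral_prod_symm' (fun p : (Fin n → ℝ) × (Fin n → ℝ) => w p * E p.2) hw2]
    refine le_trans (le_of_eq ?_) hone
    congr 1 with τ
    congr 1 with σ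
    simp only [hw, abs_sub_comm]

end Assembly

end FractionalWave

end

/-! ### The main estimate -/

theorem proposition3p3 (d : ℕ) (α H : ℝ) (hα_pos : 0 < α) (hα_lt : α < d) (hα : (d : ℝ) - 2 < α)
    (hH : 1 / 2 < H) (hH_lt : H < 1) :
    ∃ C : ℝ, 0 < C ∧
      ∀ (t : ℝ) (_ : 0 < t) (x : FractionalWave.Space d) (n : ℕ) (_ : 1 ≤ n),
        FractionalWave.HasFiniteNorm α H t
            (FractionalWave.symmetrize (FractionalWave.kernel (n := n) t x)) ∧
          FractionalWave.alphaTilde α H t x n ≤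
            (C * t ^ (2 * H + α - d + 2)) ^ n * (1 / (n.factorial : ℝ) ^ (α - d + 2)) := by
  obtain ⟨c, hc0, hc⟩ := FractionalWave.exists_lintegral_waveSymbol_le hα_pos hα_lt hα
  have hβ : 0 < α - d + 2 := by linarith
  have hG : 0 < Real.Gamma (α - d + 2 + 1) := Real.Gamma_pos_of_pos (by linarith)
  have hH1 : 0 < 2 * H - 1 := by linarith
  have hH0 : 0 < H := by linarith
  -- Factors per variable: α_H, the Schur constant, the frequency integral, and the Dirichlet
  -- integral. The remaining global factor 2 is at most 2^n since n ≥ 1, whence the witness 2D.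
  set D : ℝ := H * (2 * H - 1) * (2 / (2 * H - 1)) * c *
    (Real.exp 1 * Real.Gamma (α - d + 2 + 1)) with hD
  have hD0 : 0 < D := by positivity
  refine ⟨2 * D, by positivity, fun t ht x n hn => ?_⟩
  have hf : (0 : ℝ) < n.factorial := by exact_mod_cast n.factorial_pos
  set R : ℝ := 2 * ((2 * t ^ (2 * H - 2 + 1) / (2 * H - 2 + 1)) ^ n *
    ((n.factorial : ℝ)⁻¹ * (c ^ n *
        ((Real.exp 1 * Real.Gamma (α - d + 2 + 1)) ^ n * t ^ (n * (α - d + 2 + 1)) /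
        (n.factorial : ℝ) ^ (α - d + 2 + 1))))) with hR
  have hB0 : 0 ≤ 2 * t ^ (2 * H - 2 + 1) / (2 * H - 2 + 1) :=
    div_nonneg (by positivity) (by linarith)
  have hR0 : 0 ≤ R := by positivity
  have hlint : ∫⁻ p in FractionalWave.timeCube n t ×ˢ FractionalWave.timeCube n t,
      ‖FractionalWave.timeIntegrand α H
        (FractionalWave.symmetrize (FractionalWave.kernel t x)) p‖ₑ ≤ ENNReal.ofReal R := by
    refine (FractionalWave.lintegral_timeIntegrand_le hH hH_lt ht x).trans ?_
    rw [hR, ENNReal.ofReal_mul zero_le_two, ENNReal.ofReal_mul (pow_nonneg hB0 n),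
      ENNReal.ofReal_pow hB0, ENNReal.ofReal_ofNat]
    gcongr
    exact FractionalWave.lintegral_spatialSq_symmetrizeFun_le hc0.le hα hc ht x
  -- Finiteness at every τ, not just almost every one, because the inner integral must converge for
  -- all pairs of times.
  have hE : ∀ τ : Fin n → ℝ, FractionalWave.spatialSq α
      (FractionalWave.symmetrizeFun (FractionalWave.kernelFun t x) τ) < ⊤ := fun τ => by
    refine (FractionalWave.spatialSq_symmetrizeFun_le α t x τ).trans_lt ?_
    refine ENNReal.mul_lt_top (by simp) (ENNReal.sum_lt_top.2 fun ρ _ => ?_)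
    refine (FractionalWave.spatialSq_kernelFun_le hc t x _).trans_lt ?_
    refine (Set.indicator_le_self _ _ _).trans_lt ?_
    exact ENNReal.prod_lt_top fun j _ => ENNReal.ofReal_lt_top
  have hSm : ∀ τ : Fin n → ℝ, Measurable
      (FractionalWave.symmetrizeFun (FractionalWave.kernelFun t x) τ) :=
    FractionalWave.measurable_symmetrizeFun_kernelFun t x
  refine ⟨⟨fun τ _ => ⟨_, FractionalWave.IsFourierFunction.symmetrize
    (FractionalWave.isFourierFunction_kernel t x) τ⟩, fun τ _ σ _ => ?_,
    (FractionalWave.stronglyMeasurable_timeIntegrand α H t x).aestronglyMeasurable,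
    hlint.trans_lt ENNReal.ofReal_lt_top⟩, ?_⟩
  · refine Integrable.congr ?_ (FractionalWave.fourierFunction_mul_conj_ae_eq α t x τ σ).symm
    refine ⟨((hSm τ).mul (Complex.continuous_conj.measurable.comp (hSm σ))).aestronglyMeasurable,
      (FractionalWave.lintegral_enorm_mul_conj_le α (hSm τ)).trans_lt ?_⟩
    exact ENNReal.add_lt_top.2 ⟨hE τ, hE σ⟩
  · have hre : (∫ p in FractionalWave.timeCube n t ×ˢ FractionalWave.timeCube n t,
        FractionalWave.timeIntegrand α H
          (FractionalWave.symmetrize (FractionalWave.kernel t x)) p).re ≤ R := by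
      refine (Complex.re_le_norm _).trans ?_
      rw [← toReal_enorm]
      exact ENNReal.toReal_le_of_le_ofReal hR0
        ((enorm_integral_le_lintegral_enorm _).trans hlint)
    rw [FractionalWave.alphaTilde, FractionalWave.normSq]
    have h2n : (2 : ℝ) ≤ 2 ^ n := by
      simpa using pow_le_pow_right₀ (one_le_two (α := ℝ)) hn
    calc (n.factorial : ℝ) ^ 2 * ((H * (2 * H - 1)) ^ n *
          (∫ p in FractionalWave.timeCube n t ×ˢ FractionalWave.timeCube n t,
            FractionalWave.timeIntegrand α H
              (FractionalWave.symmetrize (FractionalWave.kernel t x)) p).re)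
        ≤ (n.factorial : ℝ) ^ 2 * ((H * (2 * H - 1)) ^ n * R) := by gcongr
      _ = 2 * ((D * t ^ (2 * H + α - d + 2)) ^ n * (1 / (n.factorial : ℝ) ^ (α - d + 2))) := by
          have e1 : t ^ (2 * H + α - d + 2) = t ^ (2 * H - 1) * t ^ (α - d + 2 + 1) := by
            rw [← Real.rpow_add ht]; ring_nf
          have e2 : t ^ (n * (α - d + 2 + 1)) = (t ^ (α - d + 2 + 1)) ^ n := by
            rw [mul_comm, Real.rpow_mul_natCast ht.le]
          have e3 : (n.factorial : ℝ) ^ (α - d + 2 + 1) =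
              (n.factorial : ℝ) ^ (α - d + 2) * n.factorial := Real.rpow_add_one hf.ne' _
          rw [hR, e1, e2, e3, show 2 * H - 2 + 1 = 2 * H - 1 by ring, hD]
          have := Real.rpow_pos_of_pos hf (α - d + 2)
          simp only [mul_pow, div_pow]
          field_simp
      _ ≤ 2 ^ n * ((D * t ^ (2 * H + α - d + 2)) ^ n *
            (1 / (n.factorial : ℝ) ^ (α - d + 2))) := by gcongr
      _ = (2 * D * t ^ (2 * H + α - d + 2)) ^ n * (1 / (n.factorial : ℝ) ^ (α - d + 2)) := by
          simp only [mul_pow]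
          ring
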